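/- Let $H$ be a finite-dimensional Hopf algebra over an arbitrary field $k$, with comultiplication $\Delta$, counit $\varepsilon$ and antipode $S$, and let $R\subseteq H$ be a Hopf subalgebra (a unital subalgebra with $\Delta(R)\subseteq R\otimes R$ and $S(R)\subseteq R$). Put $R^+=\ker(\varepsilon|_R)$ and let $V=H/R^+H$, a right $H$-module and, by restriction, a right $R$-module. For modules write $M\sim N$ (similar) if $M\oplus P\cong N^{q}$ and $N\oplus P'\cong M^{r}$ for some $q,r\in\mathbb N$ and some modules $P,P'$. Let $H^{\otimes_R n}$ be the $n$-fold tensor power of $H$ over $R$ for $n\ge 1$, and $H^{\otimes_R 0}=R$ (an $R$-$R$-bimodule). The extension $R\subseteq H$ has depth $2n+1$ ($n\ge 0$) if $H^{\otimes_R(n+1)}\sim H^{\otimes_R n}$ as $R$-$R$-bimodules, and depth $2n$ ($n\ge 1$) if $H^{\otimes_R(n+1)}\sim H^{\otimes_R n}$ as $R$-$H$-bimodules or as $H$-$R$-bimodules. The minimum depth $d(R,H)\in\mathbb N\cup\{\infty\}$ is the least depth of $R\subseteq H$, and $\infty$ if there is none. A Hopf algebra has finite representation type if it has only finitely many isomorphism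 classes of finite-dimensional indecomposable right modules. It has the Chevalley property if the tensor product over $k$ of any two simple right modules, with the diagonal action, is semisimple. Then $d(R,H)<\infty$ if any one of the following conditions holds: 1. $R$ or $H$ has finite representation type; 2. $V$ is projective as a right $R$-module or as a right $H$-module; 3. $V$ is semisimple as a right $R$-module and $R$ has the Chevalley property. Moreover, $R$ has the Chevalley property if the dual Hopf algebra $R^*$ is pointed, i.e. if every simple subcoalgebra of $R^*$ is one-dimensional. -/

import Mathlib

open scoped TensorProduct

universe u v w

noncomputable section

namespace HopfDepth

/-! ### Modules: direct summands of multiples, similarity, representation type -/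

section Modules

/-- `M` divides a multiple of `N`: `M ⊕ P ≅ N ⊕ ⋯ ⊕ N` (`q` times) for some `q` and some `P`. -/
def DividesMultiple (S : Type v) [Ring S] (M N : Type u) [AddCommGroup M] [Module S M]
    [AddCommGroup N] [Module S N] : Prop :=
  ∃ (q : ℕ) (P : Type u) (_ : AddCommGroup P) (_ : Module S P),
    Nonempty ((M × P) ≃ₗ[S] (Fin q → N))

/-- Two modules are similar if each divides a multiple of the other. -/
def Similar (S : Type v) [Ring S] (M N : Type u) [AddCommGroup M] [Module S M]
    [AddCommGroup N] [Module S N] : Prop :=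
  DividesMultiple S M N ∧ DividesMultiple S N M

/-- A nonzero module that is not the internal direct sum of two nonzero submodules. -/
def IsIndecomposable (S : Type v) [Ring S] (M : Type u) [AddCommGroup M] [Module S M] : Prop :=
  Nontrivial M ∧ ∀ N P : Submodule S M, IsCompl N P → N = ⊥ ∨ P = ⊥

/-- Finite representation type: there are, up to isomorphism, only finitely many finitely generated
indecomposable right `A`-modules. (For a finite-dimensional algebra, finitely generated means
finite-dimensional.) -/
def FiniteRepresentationType (A : Type u) [Ring A] : Prop :=
  ∃ (t : ℕ) (F : Fin t → ModuleCat.{u} Aᵐᵒᵖ),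
    ∀ (M : Type u) [AddCommGroup M] [Module Aᵐᵒᵖ M] [Module.Finite Aᵐᵒᵖ M],
      IsIndecomposable Aᵐᵒᵖ M → ∃ i, Nonempty (M ≃ₗ[Aᵐᵒᵖ] F i)

end Modules

/-! ### Bimodules and their tensor products -/

/-- An `A`-`B`-bimodule over `k`: commuting left `A`- and right `B`-module structures which induce
the same `k`-module structure. -/
structure KBimod (k : Type v) (A B : Type u) [Field k] [Ring A] [Algebra k A] [Ring B]
    [Algebra k B] where
  carrier : Type u
  [addCommGroup : AddCommGroup carrier]
  [moduleBase : Module k carrier]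
  [moduleLeft : Module A carrier]
  [moduleRight : Module Bᵐᵒᵖ carrier]
  [towerLeft : IsScalarTower k A carrier]
  [towerRight : IsScalarTower k Bᵐᵒᵖ carrier]
  [comm : SMulCommClass A Bᵐᵒᵖ carrier]

namespace KBimod

attribute [instance] addCommGroup moduleBase moduleLeft moduleRight towerLeft towerRight comm

variable {k : Type v} [Field k] {A B C D : Type u} [Ring A] [Algebra k A] [Ring B] [Algebra k B]
  [Ring C] [Algebra k C] [Ring D] [Algebra k D]

/-- An `A`-`B`-bimodule as a module over `A ⊗ Bᵒᵖ`, with `(a ⊗ b) • m = a m b`. -/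
instance moduleTensor (M : KBimod k A B) : Module (A ⊗[k] Bᵐᵒᵖ) M.carrier :=
  TensorProduct.Algebra.module

/-- Similarity of bimodules. -/
def Similar (M N : KBimod k A B) : Prop :=
  HopfDepth.Similar (A ⊗[k] Bᵐᵒᵖ) M.carrier N.carrier

/-- The algebra `A` as an `A`-`A`-bimodule. -/
def regular (k : Type v) [Field k] (A : Type u) [Ring A] [Algebra k A] : KBimod k A A where
  carrier := A

/-- Restriction of a bimodule along algebra homomorphisms on both sides. -/
def restrict (f : C →ₐ[k] A) (g : D →ₐ[k] B) (M : KBimod k A B) : KBimod k C D :=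
  letI : Module C M.carrier := Module.compHom M.carrier f.toRingHom
  letI : Module Dᵐᵒᵖ M.carrier := Module.compHom M.carrier (AlgHom.op g).toRingHom
  { carrier := M.carrier
    towerLeft := ⟨fun t c m => by
      change f (t • c) • m = t • (f c • m)
      rw [map_smul, smul_assoc]⟩
    towerRight := ⟨fun t d m => by
      change AlgHom.op g (t • d) • m = t • (AlgHom.op g d • m)
      rw [map_smul, smul_assoc]⟩
    comm := ⟨fun c d m => by
      change f c • (AlgHom.op g d • m) = AlgHom.op g d • (f c • m)
      rw [smul_comm]⟩ }

/-- The relations `m b ⊗ n = m ⊗ b n`. -/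
def balancingRelations (M : KBimod k A B) (N : KBimod k B C) :
    Submodule k (M.carrier ⊗[k] N.carrier) :=
  Submodule.span k {x | ∃ (m : M.carrier) (b : B) (n : N.carrier),
    x = (MulOpposite.op b • m) ⊗ₜ[k] n - m ⊗ₜ[k] (b • n)}

/-- The underlying `k`-module of `M ⊗_B N`. -/
def TensorCarrier (M : KBimod k A B) (N : KBimod k B C) : Type u :=
  (M.carrier ⊗[k] N.carrier) ⧸ balancingRelations M N

instance (M : KBimod k A B) (N : KBimod k B C) : AddCommGroup (TensorCarrier M N) :=
  inferInstanceAs (AddCommGroup ((M.carrier ⊗[k] N.carrier) ⧸ balancingRelations M N))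

instance (M : KBimod k A B) (N : KBimod k B C) : Module k (TensorCarrier M N) :=
  inferInstanceAs (Module k ((M.carrier ⊗[k] N.carrier) ⧸ balancingRelations M N))

/-- The class of `m ⊗ n` in `M ⊗_B N`. -/
def tmul (M : KBimod k A B) (N : KBimod k B C) (m : M.carrier) (n : N.carrier) :
    TensorCarrier M N :=
  (balancingRelations M N).mkQ (m ⊗ₜ[k] n)

theorem linearMap_ext {M : KBimod k A B} {N : KBimod k B C}
    {f g : Module.End k (TensorCarrier M N)}
    (h : ∀ m n, f (tmul M N m n) = g (tmul M N m n)) : f = g :=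
  Submodule.linearMap_qext _ (TensorProduct.ext' h)

/-- The endomorphism `m ⊗ n ↦ φ m ⊗ ψ n` of `M ⊗_B N`, for `φ` and `ψ` commuting with `B`. -/
def mapEnd (M : KBimod k A B) (N : KBimod k B C) (φ : Module.End k M.carrier)
    (ψ : Module.End k N.carrier)
    (hφ : ∀ (b : B) m, φ (MulOpposite.op b • m) = MulOpposite.op b • φ m)
    (hψ : ∀ (b : B) n, ψ (b • n) = b • ψ n) : Module.End k (TensorCarrier M N) :=
  (balancingRelations M N).mapQ (balancingRelations M N) (TensorProduct.map φ ψ) (by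
    rw [balancingRelations, Submodule.span_le]
    rintro _ ⟨m, b, n, rfl⟩
    refine Submodule.subset_span ⟨φ m, b, ψ n, ?_⟩
    simp [hφ, hψ])

theorem mapEnd_tmul (M : KBimod k A B) (N : KBimod k B C) (φ : Module.End k M.carrier)
    (ψ : Module.End k N.carrier) (hφ hψ) (m : M.carrier) (n : N.carrier) :
    mapEnd M N φ ψ hφ hψ (tmul M N m n) = tmul M N (φ m) (ψ n) := rfl

theorem add_tmul (M : KBimod k A B) (N : KBimod k B C) (m m' : M.carrier) (n : N.carrier) :
    tmul M N (m + m') n = tmul M N m n + tmul M N m' n :=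
  congrArg (balancingRelations M N).mkQ (TensorProduct.add_tmul m m' n)

theorem tmul_add (M : KBimod k A B) (N : KBimod k B C) (m : M.carrier) (n n' : N.carrier) :
    tmul M N m (n + n') = tmul M N m n + tmul M N m n' :=
  congrArg (balancingRelations M N).mkQ (TensorProduct.tmul_add m n n')

theorem smul_tmul (M : KBimod k A B) (N : KBimod k B C) (t : k) (m : M.carrier) (n : N.carrier) :
    tmul M N (t • m) n = t • tmul M N m n := rfl

theorem tmul_smul (M : KBimod k A B) (N : KBimod k B C) (t : k) (m : M.carrier) (n : N.carrier) :
    tmul M N m (t • n) = t • tmul M N m n :=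
  congrArg (balancingRelations M N).mkQ (TensorProduct.tmul_smul t m n)

/-- The left action `a (m ⊗ n) = a m ⊗ n` of `A` on `M ⊗_B N`. -/
def leftAction (M : KBimod k A B) (N : KBimod k B C) : A →ₐ[k] Module.End k (TensorCarrier M N) :=
  AlgHom.ofLinearMap
    { toFun := fun a => mapEnd M N (Algebra.lsmul k k M.carrier a) LinearMap.id
        (fun b m => by simpa using smul_comm a (MulOpposite.op b) m) (fun _ _ => rfl)
      map_add' := fun a a' => linearMap_ext fun m n => by
        simp only [mapEnd_tmul, map_add, LinearMap.add_apply, add_tmul]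
      map_smul' := fun t a => linearMap_ext fun m n => by
        simp only [mapEnd_tmul, map_smul, LinearMap.smul_apply, smul_tmul, RingHom.id_apply] }
    (linearMap_ext fun m n => by simp [mapEnd_tmul])
    (fun a a' => linearMap_ext fun m n => by simp [mapEnd_tmul])

/-- The right action `(m ⊗ n) c = m ⊗ n c` of `C` on `M ⊗_B N`. -/
def rightAction (M : KBimod k A B) (N : KBimod k B C) :
    Cᵐᵒᵖ →ₐ[k] Module.End k (TensorCarrier M N) :=
  AlgHom.ofLinearMap
    { toFun := fun c => mapEnd M N LinearMap.id (Algebra.lsmul k k N.carrier c)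
        (fun _ _ => rfl) (fun b n => by simpa using (smul_comm b c n).symm)
      map_add' := fun c c' => linearMap_ext fun m n => by
        simp only [mapEnd_tmul, map_add, LinearMap.add_apply, tmul_add]
      map_smul' := fun t c => linearMap_ext fun m n => by
        simp only [mapEnd_tmul, map_smul, LinearMap.smul_apply, tmul_smul, RingHom.id_apply] }
    (linearMap_ext fun m n => by simp [mapEnd_tmul])
    (fun c c' => linearMap_ext fun m n => by simp [mapEnd_tmul])

/-- The tensor product `M ⊗_B N` of an `A`-`B`-bimodule and a `B`-`C`-bimodule. -/
def tensor (M : KBimod k A B) (N : KBimod k B C) : KBimod k A C :=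
  letI : Module A (TensorCarrier M N) := Module.compHom _ (leftAction M N).toRingHom
  letI : Module Cᵐᵒᵖ (TensorCarrier M N) := Module.compHom _ (rightAction M N).toRingHom
  { carrier := TensorCarrier M N
    towerLeft := ⟨fun t a x => by
      change leftAction M N (t • a) x = t • leftAction M N a x
      rw [map_smul, LinearMap.smul_apply]⟩
    towerRight := ⟨fun t c x => by
      change rightAction M N (t • c) x = t • rightAction M N c x
      rw [map_smul, LinearMap.smul_apply]⟩
    comm := ⟨fun a c x => by
      have h : leftAction M N a * rightAction M N c = rightAction M N c * leftAction M N a :=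
        linearMap_ext fun m n => rfl
      exact LinearMap.congr_fun h x⟩ }

end KBimod

/-! ### Depth of a subalgebra -/

section Depth

variable {k : Type v} [Field k] {A : Type u} [Ring A] [Algebra k A]

/-- The `A`-`A`-bimodule `A ⊗_B ⋯ ⊗_B A` with `n + 1` factors. -/
def tensorPow (B : Subalgebra k A) : ℕ → KBimod k A A
  | 0 => KBimod.regular k A
  | n + 1 => ((tensorPow B n).restrict (AlgHom.id k A) B.val).tensor
      ((KBimod.regular k A).restrict B.val (AlgHom.id k A))

/-- The `B`-`B`-bimodule `A ⊗_B ⋯ ⊗_B A` with `n` factors; it is `B` for `n = 0`. -/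
def tensorPowSub (B : Subalgebra k A) : ℕ → KBimod k B B
  | 0 => KBimod.regular k B
  | n + 1 => (tensorPow B n).restrict B.val B.val

/-- `B ⊆ A` has depth `2 n + 1`: the tensor powers of `A` over `B` with `n + 1` and `n` factors are
similar as `B`-`B`-bimodules. -/
def HasOddDepth (B : Subalgebra k A) (n : ℕ) : Prop :=
  (tensorPowSub B (n + 1)).Similar (tensorPowSub B n)

/-- `B ⊆ A` has left depth `2 (n + 1)`: the tensor powers of `A` over `B` with `n + 2` and `n + 1`
factors are similar as `B`-`A`-bimodules. -/
def HasLeftDepth (B : Subalgebra k A) (n : ℕ) : Prop :=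
  ((tensorPow B (n + 1)).restrict B.val (AlgHom.id k A)).Similar
    ((tensorPow B n).restrict B.val (AlgHom.id k A))

/-- `B ⊆ A` has right depth `2 (n + 1)`: the tensor powers of `A` over `B` with `n + 2` and `n + 1`
factors are similar as `A`-`B`-bimodules. -/
def HasRightDepth (B : Subalgebra k A) (n : ℕ) : Prop :=
  ((tensorPow B (n + 1)).restrict (AlgHom.id k A) B.val).Similar
    ((tensorPow B n).restrict (AlgHom.id k A) B.val)

/-- `B ⊆ A` has depth `d`; for even `d` this means left or right depth `d`. -/
def HasDepth (B : Subalgebra k A) (d : ℕ) : Prop :=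
  (∃ n, d = 2 * n + 1 ∧ HasOddDepth B n) ∨
    (∃ n, d = 2 * (n + 1) ∧ (HasLeftDepth B n ∨ HasRightDepth B n))

/-- The minimum depth `d(B, A)`, which is `⊤` if there is no finite depth. -/
def minDepth (B : Subalgebra k A) : ℕ∞ :=
  sInf {d : ℕ∞ | ∃ m : ℕ, d = m ∧ HasDepth B m}

end Depth

/-! ### Hopf subalgebras -/

/-- A Hopf subalgebra: a subalgebra `R` with `Δ(R) ⊆ R ⊗ R` and `S(R) ⊆ R`. -/
structure HopfSubalgebra (k : Type v) (H : Type u) [Field k] [Ring H] [HopfAlgebra k H] extends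
    Subalgebra k H where
  comul_mem' : ∀ x ∈ toSubalgebra, Coalgebra.comul (R := k) x ∈
    (Algebra.TensorProduct.map toSubalgebra.val toSubalgebra.val).range
  antipode_mem' : ∀ x ∈ toSubalgebra, HopfAlgebra.antipode k x ∈ toSubalgebra

namespace HopfSubalgebra

variable {k : Type v} {H : Type u} [Field k] [Ring H] [HopfAlgebra k H] (R : HopfSubalgebra k H)

/-- The underlying algebra of a Hopf subalgebra. -/
abbrev Carrier : Type u := R.toSubalgebra

/-- The inclusion `R ⊗ R → H ⊗ H`. -/
abbrev inclTensor : R.Carrier ⊗[k] R.Carrier →ₐ[k] H ⊗[k] H :=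
  Algebra.TensorProduct.map R.toSubalgebra.val R.toSubalgebra.val

theorem inclTensor_injective : Function.Injective R.inclTensor :=
  TensorProduct.map_injective_of_flat_flat R.toSubalgebra.val.toLinearMap
    R.toSubalgebra.val.toLinearMap Subtype.val_injective Subtype.val_injective

/-- The comultiplication of `H` restricted to `R → R ⊗ R`. -/
def comulRestrict : R.Carrier →ₐ[k] R.Carrier ⊗[k] R.Carrier :=
  (AlgEquiv.ofInjective R.inclTensor R.inclTensor_injective).symm.toAlgHom.comp
    (((Bialgebra.comulAlgHom k H).comp R.toSubalgebra.val).codRestrict R.inclTensor.range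
      fun x => R.comul_mem' x x.2)

theorem inclTensor_comulRestrict (x : R.Carrier) :
    R.inclTensor (R.comulRestrict x) = Coalgebra.comul (R := k) (x : H) :=
  congrArg Subtype.val ((AlgEquiv.ofInjective R.inclTensor R.inclTensor_injective).apply_symm_apply
    ⟨Coalgebra.comul (R := k) (x : H), R.comul_mem' x x.2⟩)

theorem inclTensor_comp_comulRestrict :
    R.inclTensor.comp R.comulRestrict = (Bialgebra.comulAlgHom k H).comp R.toSubalgebra.val :=
  AlgHom.ext R.inclTensor_comulRestrict

/-- The inclusion `R ⊗ (R ⊗ R) → H ⊗ (H ⊗ H)` is injective. -/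
theorem inclTensor₃_injective :
    Function.Injective (Algebra.TensorProduct.map R.toSubalgebra.val R.inclTensor) :=
  TensorProduct.map_injective_of_flat_flat R.toSubalgebra.val.toLinearMap
    R.inclTensor.toLinearMap Subtype.val_injective R.inclTensor_injective

theorem incl_assoc (z : (R.Carrier ⊗[k] R.Carrier) ⊗[k] R.Carrier) :
    Algebra.TensorProduct.map R.toSubalgebra.val R.inclTensor
        (Algebra.TensorProduct.assoc k k k R.Carrier R.Carrier R.Carrier z) =
      Algebra.TensorProduct.assoc k k k H H H
        (Algebra.TensorProduct.map R.inclTensor R.toSubalgebra.val z) := by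
  induction z with
  | zero => simp only [map_zero]
  | add a b ha hb => simp only [map_add, ha, hb]
  | tmul a c =>
    induction a with
    | zero => simp only [TensorProduct.zero_tmul, map_zero]
    | add a b ha hb => simp only [TensorProduct.add_tmul, map_add, ha, hb]
    | tmul a b => rfl

theorem incl_comul_left (y : R.Carrier ⊗[k] R.Carrier) :
    Algebra.TensorProduct.map R.inclTensor R.toSubalgebra.val
        (Algebra.TensorProduct.map R.comulRestrict (.id k R.Carrier) y) =
      Algebra.TensorProduct.map (Bialgebra.comulAlgHom k H) (.id k H) (R.inclTensor y) := by
  induction y with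
  | zero => simp only [map_zero]
  | add a b ha hb => simp only [map_add, ha, hb]
  | tmul a b =>
    simp only [Algebra.TensorProduct.map_tmul, inclTensor_comulRestrict]
    rfl

theorem incl_comul_right (y : R.Carrier ⊗[k] R.Carrier) :
    Algebra.TensorProduct.map R.toSubalgebra.val R.inclTensor
        (Algebra.TensorProduct.map (.id k R.Carrier) R.comulRestrict y) =
      Algebra.TensorProduct.map (.id k H) (Bialgebra.comulAlgHom k H) (R.inclTensor y) := by
  induction y with
  | zero => simp only [map_zero]
  | add a b ha hb => simp only [map_add, ha, hb]
  | tmul a b =>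
    simp only [Algebra.TensorProduct.map_tmul, inclTensor_comulRestrict]
    rfl

theorem incl_counit_left (y : R.Carrier ⊗[k] R.Carrier) :
    Algebra.TensorProduct.map (.id k k) R.toSubalgebra.val (Algebra.TensorProduct.map
        ((Bialgebra.counitAlgHom k H).comp R.toSubalgebra.val) (.id k R.Carrier) y) =
      Algebra.TensorProduct.map (Bialgebra.counitAlgHom k H) (.id k H) (R.inclTensor y) := by
  induction y with
  | zero => simp only [map_zero]
  | add a b ha hb => simp only [map_add, ha, hb]
  | tmul a b => rfl

theorem incl_counit_right (y : R.Carrier ⊗[k] R.Carrier) :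
    Algebra.TensorProduct.map R.toSubalgebra.val (.id k k) (Algebra.TensorProduct.map
        (.id k R.Carrier) ((Bialgebra.counitAlgHom k H).comp R.toSubalgebra.val) y) =
      Algebra.TensorProduct.map (.id k H) (Bialgebra.counitAlgHom k H) (R.inclTensor y) := by
  induction y with
  | zero => simp only [map_zero]
  | add a b ha hb => simp only [map_add, ha, hb]
  | tmul a b => rfl

/-- The bialgebra structure of a Hopf subalgebra, restricted from `H`. -/
instance bialgebra : Bialgebra k R.Carrier :=
  Bialgebra.ofAlgHom R.comulRestrict ((Bialgebra.counitAlgHom k H).comp R.toSubalgebra.val)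
    (AlgHom.ext fun x => R.inclTensor₃_injective <| by
      have h := Coalgebra.coassoc_apply (R := k) (x : H)
      refine (R.incl_assoc _).trans ?_
      refine Eq.trans ?_ (R.incl_comul_right (R.comulRestrict x)).symm
      refine (congrArg _ (R.incl_comul_left (R.comulRestrict x))).trans ?_
      rw [inclTensor_comulRestrict]
      exact h)
    (AlgHom.ext fun x => by
      have hinj : Function.Injective
          (Algebra.TensorProduct.map (.id k k) R.toSubalgebra.val) :=
        TensorProduct.map_injective_of_flat_flat LinearMap.id
          R.toSubalgebra.val.toLinearMap Function.injective_id Subtype.val_injective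
      apply hinj
      refine (R.incl_counit_left (R.comulRestrict x)).trans ?_
      rw [inclTensor_comulRestrict]
      exact Coalgebra.rTensor_counit_comul (R := k) (x : H))
    (AlgHom.ext fun x => by
      have hinj : Function.Injective
          (Algebra.TensorProduct.map R.toSubalgebra.val (.id k k)) :=
        TensorProduct.map_injective_of_flat_flat R.toSubalgebra.val.toLinearMap
          LinearMap.id Subtype.val_injective Function.injective_id
      apply hinj
      refine (R.incl_counit_right (R.comulRestrict x)).trans ?_
      rw [inclTensor_comulRestrict]
      exact Coalgebra.lTensor_counit_comul (R := k) (x : H))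

theorem coe_counit (x : R.Carrier) :
    Coalgebra.counit (R := k) x = Coalgebra.counit (R := k) (x : H) := rfl

theorem inclTensor_comul (x : R.Carrier) :
    R.inclTensor (Coalgebra.comul (R := k) x) = Coalgebra.comul (R := k) (x : H) :=
  R.inclTensor_comulRestrict x

/-- The antipode of `H` restricted to `R → R`. -/
def antipodeRestrict : R.Carrier →ₗ[k] R.Carrier :=
  LinearMap.codRestrict (Subalgebra.toSubmodule R.toSubalgebra)
    (HopfAlgebra.antipode k (A := H) ∘ₗ R.toSubalgebra.val.toLinearMap)
    fun x => R.antipode_mem' x x.2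

theorem coe_mul_antipode_left (y : R.Carrier ⊗[k] R.Carrier) :
    (LinearMap.mul' k R.Carrier (R.antipodeRestrict.rTensor R.Carrier y) : H) =
      LinearMap.mul' k H ((HopfAlgebra.antipode k (A := H)).rTensor H (R.inclTensor y)) := by
  induction y with
  | zero => simp only [map_zero, ZeroMemClass.coe_zero]
  | add a b ha hb => simp only [map_add, ← ha, ← hb, AddMemClass.coe_add]
  | tmul a b => rfl

theorem coe_mul_antipode_right (y : R.Carrier ⊗[k] R.Carrier) :
    (LinearMap.mul' k R.Carrier (R.antipodeRestrict.lTensor R.Carrier y) : H) =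
      LinearMap.mul' k H ((HopfAlgebra.antipode k (A := H)).lTensor H (R.inclTensor y)) := by
  induction y with
  | zero => simp only [map_zero, ZeroMemClass.coe_zero]
  | add a b ha hb => simp only [map_add, ← ha, ← hb, AddMemClass.coe_add]
  | tmul a b => rfl

/-- The Hopf algebra structure of a Hopf subalgebra, restricted from `H`. -/
instance hopfAlgebra : HopfAlgebra k R.Carrier where
  antipode := R.antipodeRestrict
  mul_antipode_rTensor_comul := LinearMap.ext fun x => Subtype.ext <| by
    refine (R.coe_mul_antipode_left (R.comulRestrict x)).trans ?_
    rw [inclTensor_comulRestrict]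
    exact HopfAlgebra.mul_antipode_rTensor_comul_apply (R := k) (x : H)
  mul_antipode_lTensor_comul := LinearMap.ext fun x => Subtype.ext <| by
    refine (R.coe_mul_antipode_right (R.comulRestrict x)).trans ?_
    rw [inclTensor_comulRestrict]
    exact HopfAlgebra.mul_antipode_lTensor_comul_apply (R := k) (x : H)

/-- The right ideal `R⁺ H` of `H`, where `R⁺` is the kernel of the counit of `R`. -/
def augIdeal : Submodule Hᵐᵒᵖ H :=
  Submodule.span Hᵐᵒᵖ {x | x ∈ R.toSubalgebra ∧ Coalgebra.counit (R := k) x = 0}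

/-- The generalized permutation module `V = H / R⁺ H`, a right `H`-module. -/
def PermModule : Type u := H ⧸ R.augIdeal

instance : AddCommGroup R.PermModule := inferInstanceAs (AddCommGroup (H ⧸ R.augIdeal))

instance : Module Hᵐᵒᵖ R.PermModule := inferInstanceAs (Module Hᵐᵒᵖ (H ⧸ R.augIdeal))

/-- `V` as a right `R`-module, by restriction. -/
instance : Module R.Carrierᵐᵒᵖ R.PermModule :=
  Module.compHom R.PermModule (AlgHom.op R.toSubalgebra.val).toRingHom

end HopfSubalgebra

/-! ### Tensor products of right modules and the Chevalley property -/

section Chevalley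

variable (k : Type v) [Field k] (A : Type u) [Ring A] [Bialgebra k A]

/-- The tensor product `M ⊗ N` over `k` of two right modules over a bialgebra `A`. -/
def RightTensor (M N : Type u) [AddCommGroup M] [Module k M] [AddCommGroup N] [Module k N] :
    Type u := M ⊗[k] N

variable (M N : Type u) [AddCommGroup M] [Module k M] [Module Aᵐᵒᵖ M] [IsScalarTower k Aᵐᵒᵖ M]
  [AddCommGroup N] [Module k N] [Module Aᵐᵒᵖ N] [IsScalarTower k Aᵐᵒᵖ N]

instance : AddCommGroup (RightTensor k M N) := inferInstanceAs (AddCommGroup (M ⊗[k] N))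

instance : Module k (RightTensor k M N) := inferInstanceAs (Module k (M ⊗[k] N))

/-- The diagonal action `(m ⊗ n) a = ∑ m a₍₁₎ ⊗ n a₍₂₎`. -/
def diagonalAction : Aᵐᵒᵖ →ₐ[k] Module.End k (M ⊗[k] N) :=
  ((Module.endTensorEndAlgHom (R := k) (S := k) (A := k) (M := M) (N := N)).comp
    (Algebra.TensorProduct.map (Algebra.lsmul k k M) (Algebra.lsmul k k N))).comp
      ((Algebra.TensorProduct.opAlgEquiv k k A A).symm.toAlgHom.comp
        (AlgHom.op (Bialgebra.comulAlgHom k A)))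

instance rightTensorModule : Module Aᵐᵒᵖ (RightTensor k M N) :=
  Module.compHom (M ⊗[k] N) (diagonalAction k A M N).toRingHom

/-- The Chevalley property: the tensor product of two simple (right) modules is semisimple. -/
def ChevalleyProperty : Prop :=
  ∀ (M N : Type u) [AddCommGroup M] [Module k M] [Module Aᵐᵒᵖ M] [IsScalarTower k Aᵐᵒᵖ M]
    [AddCommGroup N] [Module k N] [Module Aᵐᵒᵖ N] [IsScalarTower k Aᵐᵒᵖ N],
    IsSimpleModule Aᵐᵒᵖ M → IsSimpleModule Aᵐᵒᵖ N → IsSemisimpleModule Aᵐᵒᵖ (RightTensor k M N)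

end Chevalley

/-! ### Pointed coalgebras and the dual coalgebra -/

section Pointed

variable {k : Type v} [Field k]

/-- A subcoalgebra of `C`: a subspace `D` with `Δ(D) ⊆ D ⊗ D`. -/
def IsSubcoalgebra {C : Type u} [AddCommGroup C] [Module k C] [Coalgebra k C]
    (D : Submodule k C) : Prop :=
  ∀ x ∈ D, Coalgebra.comul (R := k) x ∈ LinearMap.range (TensorProduct.map D.subtype D.subtype)

/-- A simple subcoalgebra: nonzero and without proper nonzero subcoalgebras. -/
def IsSimpleSubcoalgebra {C : Type u} [AddCommGroup C] [Module k C] [Coalgebra k C]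
    (D : Submodule k C) : Prop :=
  IsSubcoalgebra D ∧ D ≠ ⊥ ∧ ∀ E : Submodule k C, IsSubcoalgebra E → E ≤ D → E = ⊥ ∨ E = D

variable (k) in
/-- A coalgebra is pointed if its simple subcoalgebras are one-dimensional. -/
def IsPointed (C : Type u) [AddCommGroup C] [Module k C] [Coalgebra k C] : Prop :=
  ∀ D : Submodule k C, IsSimpleSubcoalgebra D → Module.finrank k D = 1

variable (k) in
/-- The comultiplication of the dual of a finite-dimensional algebra: the transpose of the
multiplication, followed by `(A ⊗ A)* ≅ A* ⊗ A*`. -/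
def dualComul (A : Type u) [Ring A] [Algebra k A] [FiniteDimensional k A] :
    Module.Dual k A →ₗ[k] Module.Dual k A ⊗[k] Module.Dual k A :=
  (TensorProduct.dualDistribEquiv k A A).symm.toLinearMap ∘ₗ
    Module.Dual.transpose (LinearMap.mul' k A)

theorem dualDistrib_dualComul {A : Type u} [Ring A] [Algebra k A] [FiniteDimensional k A]
    (f : Module.Dual k A) (a b : A) :
    TensorProduct.dualDistrib k A A (dualComul k A f) (a ⊗ₜ b) = f (a * b) := by
  have h := (TensorProduct.dualDistribEquiv k A A).apply_symm_apply
    (Module.Dual.transpose (LinearMap.mul' k A) f)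
  exact LinearMap.congr_fun h (a ⊗ₜ b)

/-- Elements of `A* ⊗ A* ⊗ A*` are determined by their values on `A × A × A`. -/
theorem dual_tensor₃_ext {A : Type u} [Ring A] [Algebra k A] [FiniteDimensional k A]
    {x y : Module.Dual k A ⊗[k] (Module.Dual k A ⊗[k] Module.Dual k A)}
    (h : ∀ a b c : A,
      TensorProduct.dualDistrib k A (A ⊗[k] A)
        ((TensorProduct.dualDistrib k A A).lTensor _ x) (a ⊗ₜ (b ⊗ₜ c)) =
      TensorProduct.dualDistrib k A (A ⊗[k] A)
        ((TensorProduct.dualDistrib k A A).lTensor _ y) (a ⊗ₜ (b ⊗ₜ c))) : x = y := by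
  have h₁ : Function.Injective (TensorProduct.dualDistrib k A A) :=
    (TensorProduct.dualDistribEquiv k A A).injective
  have h₂ : Function.Injective (TensorProduct.dualDistrib k A (A ⊗[k] A)) :=
    (TensorProduct.dualDistribEquiv k A (A ⊗[k] A)).injective
  refine Module.Flat.lTensor_preserves_injective_linearMap _ h₁ (h₂ ?_)
  refine TensorProduct.ext' fun a z => ?_
  induction z with
  | zero => simp only [TensorProduct.tmul_zero, map_zero]
  | add z w hz hw => simp only [TensorProduct.tmul_add, map_add, hz, hw]
  | tmul b c => exact h a b c

theorem dual_assoc_eval {A : Type u} [Ring A] [Algebra k A] [FiniteDimensional k A]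
    (y : Module.Dual k A ⊗[k] Module.Dual k A) (a b c : A) :
    TensorProduct.dualDistrib k A (A ⊗[k] A) ((TensorProduct.dualDistrib k A A).lTensor _
        (TensorProduct.assoc k _ _ _ ((dualComul k A).rTensor _ y))) (a ⊗ₜ (b ⊗ₜ c)) =
      TensorProduct.dualDistrib k A A y ((a * b) ⊗ₜ c) := by
  induction y with
  | zero => simp only [map_zero, LinearMap.zero_apply]
  | add y z hy hz => simp only [map_add, LinearMap.add_apply, hy, hz]
  | tmul f g =>
    rw [LinearMap.rTensor_tmul, TensorProduct.dualDistrib_apply, ← dualDistrib_dualComul]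
    generalize dualComul k A f = z
    induction z with
    | zero => simp
    | add y z hy hz => simp only [TensorProduct.add_tmul, map_add, LinearMap.add_apply, hy, hz,
        add_mul]
    | tmul p q => simp [mul_assoc]

theorem dual_lTensor_eval {A : Type u} [Ring A] [Algebra k A] [FiniteDimensional k A]
    (y : Module.Dual k A ⊗[k] Module.Dual k A) (a b c : A) :
    TensorProduct.dualDistrib k A (A ⊗[k] A) ((TensorProduct.dualDistrib k A A).lTensor _
        ((dualComul k A).lTensor _ y)) (a ⊗ₜ (b ⊗ₜ c)) =
      TensorProduct.dualDistrib k A A y (a ⊗ₜ (b * c)) := by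
  induction y with
  | zero => simp only [map_zero, LinearMap.zero_apply]
  | add y z hy hz => simp only [map_add, LinearMap.add_apply, hy, hz]
  | tmul f g => simp [dualDistrib_dualComul]

theorem dual_lid_eval {A : Type u} [Ring A] [Algebra k A] [FiniteDimensional k A]
    (y : Module.Dual k A ⊗[k] Module.Dual k A) (a : A) :
    TensorProduct.lid k _ ((Module.Dual.eval k A 1).rTensor _ y) a =
      TensorProduct.dualDistrib k A A y (1 ⊗ₜ a) := by
  induction y with
  | zero => simp only [map_zero, LinearMap.zero_apply]
  | add y z hy hz => simp only [map_add, LinearMap.add_apply, hy, hz]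
  | tmul f g => simp

theorem dual_rid_eval {A : Type u} [Ring A] [Algebra k A] [FiniteDimensional k A]
    (y : Module.Dual k A ⊗[k] Module.Dual k A) (a : A) :
    TensorProduct.rid k _ ((Module.Dual.eval k A 1).lTensor _ y) a =
      TensorProduct.dualDistrib k A A y (a ⊗ₜ 1) := by
  induction y with
  | zero => simp only [map_zero, LinearMap.zero_apply]
  | add y z hy hz => simp only [map_add, LinearMap.add_apply, hy, hz]
  | tmul f g => simp [mul_comm]

variable (k) in
/-- The dual coalgebra `A*` of a finite-dimensional algebra `A`; the counit is evaluation at `1`. -/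
@[reducible] def dualCoalgebra (A : Type u) [Ring A] [Algebra k A] [FiniteDimensional k A] :
    Coalgebra k (Module.Dual k A) where
  comul := dualComul k A
  counit := Module.Dual.eval k A 1
  coassoc := LinearMap.ext fun f => dual_tensor₃_ext fun a b c => by
    refine (dual_assoc_eval _ a b c).trans (Eq.trans ?_ (dual_lTensor_eval _ a b c).symm)
    rw [dualDistrib_dualComul, dualDistrib_dualComul, mul_assoc]
  rTensor_counit_comp_comul := LinearMap.ext fun f => (TensorProduct.lid k _).injective <|
    LinearMap.ext fun a => by
      refine (dual_lid_eval _ a).trans ?_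
      rw [dualDistrib_dualComul]
      simp
  lTensor_counit_comp_comul := LinearMap.ext fun f => (TensorProduct.rid k _).injective <|
    LinearMap.ext fun a => by
      refine (dual_rid_eval _ a).trans ?_
      rw [dualDistrib_dualComul]
      simp

variable (k) in
/-- The dual `A*` of the finite-dimensional algebra `A` is pointed. -/
def DualIsPointed (A : Type u) [Ring A] [Algebra k A] [FiniteDimensional k A] : Prop :=
  letI := dualCoalgebra k A
  IsPointed k (Module.Dual k A)

end Pointed

end HopfDepth

end

/-!
Let `V = H / R⁺H`. For a right `H`-module `M` there is an isomorphism `M ⊗_R H ≅ M ⊗ V` onto the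
diagonal tensor product, `m ⊗ h ↦ (m ⊗ 1̄) h`, with inverse `m ⊗ h̄ ↦ m S(h₁) ⊗ h₂`. Iterating,
`H ⊗_R ⋯ ⊗_R H ≅ H ⊗ V ⊗ ⋯ ⊗ V` as bimodules. Over `R` the class `1̄` is invariant, so the `n`-th
tensor power `Vₙ` of `V` is a retract of `Vₙ₊₁` via `m ↦ m ⊗ 1̄` and the counit, and the depth is
finite as soon as, over `R`, some `Vₙ₊₁` is a summand of a multiple of `Vₙ`.

* In finite representation type, the set of indecomposables which, over `R`, are summands of
  multiples of `Vₙ` increases with `n` inside a finite set.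
* If `V` is projective, then so is every `M ⊗ V`, because the antipode untwists `M ⊗ H` to a free
  module. The trace ideals of the `Vₙ` increase in a Noetherian ring, and where they agree `Vₙ₊₁`
  is generated by `Vₙ`, so it is a summand of a multiple of `Vₙ`.
* If `V` is semisimple and `R` has the Chevalley property, all `Vₙ` are semisimple. Their
  annihilators decrease in an Artinian ring, and where they agree `Vₙ₊₁` is generated by `Vₙ`.

If `A*` is pointed, the functionals vanishing on the annihilator of a simple `A`-module form a
non-zero subcoalgebra of `A*`, which contains a line spanned by some `f` with `Δ f = c • f ⊗ f`.
The simple module then embeds into `k`, and tensor products of one-dimensional modules are simple.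
-/

noncomputable section

namespace HopfDepth

open Coalgebra MulOpposite

/-! ### Direct summands of multiples -/

section SummandOfMultiple

/-- `M` is a direct summand of a multiple of `N`. The splitting `M → N ^ q → M` is recorded by its
components, so that it is visibly preserved by every additive functor. -/
def SummandOfMultiple (S : Type*) [Ring S] (M N : Type*) [AddCommGroup M] [Module S M]
    [AddCommGroup N] [Module S N] : Prop :=
  ∃ (q : ℕ) (f : Fin q → M →ₗ[S] N) (g : Fin q → N →ₗ[S] M), ∑ i, g i ∘ₗ f i = LinearMap.id

variable {S : Type*} [Ring S] {M N P : Type*} [AddCommGroup M] [Module S M]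
  [AddCommGroup N] [Module S N] [AddCommGroup P] [Module S P]

namespace SummandOfMultiple

theorem of_fintype {ι : Type*} [Fintype ι] (f : ι → M →ₗ[S] N) (g : ι → N →ₗ[S] M)
    (h : ∑ i, g i ∘ₗ f i = LinearMap.id) : SummandOfMultiple S M N :=
  ⟨Fintype.card ι, f ∘ (Fintype.equivFin ι).symm, g ∘ (Fintype.equivFin ι).symm,
    ((Fintype.equivFin ι).symm.sum_comp fun i => g i ∘ₗ f i).trans h⟩

theorem of_sum_comp_eq_id {ι : Type*} [Fintype ι] {X : ι → Type*} [∀ i, AddCommGroup (X i)]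
    [∀ i, Module S (X i)] (p : ∀ i, M →ₗ[S] X i) (j : ∀ i, X i →ₗ[S] M)
    (h : ∑ i, j i ∘ₗ p i = LinearMap.id) (hX : ∀ i, SummandOfMultiple S (X i) N) :
    SummandOfMultiple S M N := by
  choose q f g hfg using hX
  refine of_fintype (ι := Σ i, Fin (q i)) (fun s => f s.1 s.2 ∘ₗ p s.1)
    (fun s => j s.1 ∘ₗ g s.1 s.2) (Eq.trans ?_ h)
  rw [Fintype.sum_sigma]
  refine Finset.sum_congr rfl fun i _ => LinearMap.ext fun x => ?_
  simpa only [LinearMap.sum_apply, LinearMap.comp_apply, map_sum, LinearMap.id_apply]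
    using congrArg (j i) (LinearMap.congr_fun (hfg i) (p i x))

theorem trans (hMN : SummandOfMultiple S M N) (hNP : SummandOfMultiple S N P) :
    SummandOfMultiple S M P := by
  obtain ⟨q, f, g, hfg⟩ := hMN
  exact of_sum_comp_eq_id f g hfg fun _ => hNP

theorem of_retract (f : M →ₗ[S] N) (g : N →ₗ[S] M) (h : g ∘ₗ f = LinearMap.id) :
    SummandOfMultiple S M N :=
  ⟨1, fun _ => f, fun _ => g, by simpa using h⟩

theorem of_equiv (e : M ≃ₗ[S] N) : SummandOfMultiple S M N :=
  of_retract e.toLinearMap e.symm.toLinearMap e.symm_comp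

theorem of_pi_retract {ι : Type*} [Finite ι] (f : M →ₗ[S] (ι → N)) (g : (ι → N) →ₗ[S] M)
    (h : g ∘ₗ f = LinearMap.id) : SummandOfMultiple S M N := by
  classical
  have := Fintype.ofFinite ι
  refine of_fintype (fun i => LinearMap.proj i ∘ₗ f)
    (fun i => g ∘ₗ LinearMap.single S (fun _ => N) i) (LinearMap.ext fun x => ?_)
  have hx : g (f x) = x := LinearMap.congr_fun h x
  rw [← Finset.univ_sum_single (f x), map_sum] at hx
  simpa using hx

theorem exists_pi_retract (h : SummandOfMultiple S M N) :
    ∃ (q : ℕ) (f : M →ₗ[S] (Fin q → N)) (g : (Fin q → N) →ₗ[S] M), g ∘ₗ f = LinearMap.id := by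
  obtain ⟨q, f, g, hfg⟩ := h
  refine ⟨q, LinearMap.pi f, ∑ j, g j ∘ₗ LinearMap.proj j, LinearMap.ext fun x => ?_⟩
  simpa using LinearMap.congr_fun hfg x

theorem dividesMultiple {S : Type v} [Ring S] {M N : Type u} [AddCommGroup M] [Module S M]
    [AddCommGroup N] [Module S N] (h : SummandOfMultiple S M N) : DividesMultiple S M N := by
  obtain ⟨q, f, g, hgf⟩ := h.exists_pi_retract
  have e := (g.exact_subtype_ker_map.splitSurjectiveEquiv (Submodule.subtype_injective _)
    ⟨f, hgf⟩).1
  exact ⟨q, LinearMap.ker g, inferInstance, inferInstance,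
    ⟨(e ≪≫ₗ LinearEquiv.prodComm S _ _).symm⟩⟩

end SummandOfMultiple

theorem similar_of_summandOfMultiple {S : Type v} [Ring S] {M N : Type u} [AddCommGroup M]
    [Module S M] [AddCommGroup N] [Module S N] (hMN : SummandOfMultiple S M N)
    (hNM : SummandOfMultiple S N M) : Similar S M N :=
  ⟨hMN.dividesMultiple, hNM.dividesMultiple⟩

theorem summandOfMultiple_self_iff :
    SummandOfMultiple S M S ↔ Module.Finite S M ∧ Module.Projective S M := by
  constructor
  · intro h
    obtain ⟨q, f, g, hgf⟩ := h.exists_pi_retract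
    exact ⟨.of_surjective g fun x => ⟨f x, LinearMap.congr_fun hgf x⟩, .of_split f g hgf⟩
  · rintro ⟨_, _⟩
    obtain ⟨q, g, f, -, -, hgf⟩ := Module.Finite.exists_comp_eq_id_of_projective S M
    exact .of_pi_retract f g hgf

variable (S M N) in
/-- The trace of `N` in `M`: the largest submodule of `M` generated by `N`. -/
def traceSubmodule : Submodule S M := ⨆ f : N →ₗ[S] M, LinearMap.range f

theorem apply_mem_traceSubmodule (f : N →ₗ[S] M) (x : N) : f x ∈ traceSubmodule S M N :=
  Submodule.mem_iSup_of_mem f ⟨x, rfl⟩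

theorem map_traceSubmodule_le (g : M →ₗ[S] P) :
    (traceSubmodule S M N).map g ≤ traceSubmodule S P N := by
  rw [Submodule.map_le_iff_le_comap]
  refine iSup_le fun f => ?_
  rintro _ ⟨x, rfl⟩
  exact apply_mem_traceSubmodule (g ∘ₗ f) x

theorem traceSubmodule_le_of_surjective (p : P →ₗ[S] N) (hp : Function.Surjective p) :
    traceSubmodule S M N ≤ traceSubmodule S M P := by
  refine iSup_le fun f => ?_
  rw [← LinearMap.range_comp_of_range_eq_top f (LinearMap.range_eq_top.mpr hp)]
  exact le_iSup (fun f : P →ₗ[S] M => LinearMap.range f) (f ∘ₗ p)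

theorem exists_surjective_pi_of_traceSubmodule_eq_top [Module.Finite S M]
    (h : traceSubmodule S M N = ⊤) :
    ∃ (s : Finset (N →ₗ[S] M)) (p : (s → N) →ₗ[S] M), Function.Surjective p := by
  classical
  have hcompact := (Submodule.fg_iff_compact (⊤ : Submodule S M)).mp Module.Finite.fg_top
  obtain ⟨s, hs⟩ := CompleteLattice.IsCompactElement.exists_finset_of_le_iSup _ hcompact
    (fun f : N →ₗ[S] M => LinearMap.range f) h.ge
  refine ⟨s, LinearMap.lsum S (fun _ => N) ℕ Subtype.val, LinearMap.range_eq_top.mp ?_⟩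
  refine top_le_iff.mp (hs.trans (iSup₂_le fun f hf => ?_))
  rintro _ ⟨x, rfl⟩
  exact ⟨Pi.single ⟨f, hf⟩ x, LinearMap.lsum_piSingle _ _ _ _ _ _⟩

theorem summandOfMultiple_of_projective [Module.Finite S M] [Module.Projective S M]
    (h : traceSubmodule S M N = ⊤) : SummandOfMultiple S M N := by
  obtain ⟨_, p, hp⟩ := exists_surjective_pi_of_traceSubmodule_eq_top h
  obtain ⟨s, hs⟩ := Module.projective_lifting_property p LinearMap.id hp
  exact .of_pi_retract s p hs

theorem summandOfMultiple_of_isSemisimpleModule [Module.Finite S M] [IsSemisimpleModule S N]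
    (h : traceSubmodule S M N = ⊤) : SummandOfMultiple S M N := by
  obtain ⟨_, p, hp⟩ := exists_surjective_pi_of_traceSubmodule_eq_top h
  obtain ⟨s, hs⟩ := IsSemisimpleModule.lifting_property p hp LinearMap.id
  exact .of_pi_retract s p hs

end SummandOfMultiple

/-! ### Towers of modules that become stationary -/

section Towers

section Projective

variable {S : Type*} [Ring S]

-- A projective module `M` satisfies `M = T M`, where `T` is its trace ideal.
theorem traceSubmodule_eq_top_of_projective {M N : Type*} [AddCommGroup M] [Module S M]
    [AddCommGroup N] [Module S N] [Module.Projective S M]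
    (h : traceSubmodule S S M ≤ traceSubmodule S S N) : traceSubmodule S M N = ⊤ := by
  obtain ⟨s, hs⟩ := Module.projective_def'.mp ‹Module.Projective S M›
  refine eq_top_iff.mpr fun x _ => ?_
  rw [show x = (s x).sum fun m a => a • m from (LinearMap.congr_fun hs x).symm]
  refine Submodule.sum_mem _ fun m _ => ?_
  have hsx : s x m ∈ traceSubmodule S S N :=
    h (apply_mem_traceSubmodule (Finsupp.lapply m ∘ₗ s) x)
  exact map_traceSubmodule_le (LinearMap.toSpanSingleton S M m) ⟨_, hsx, rfl⟩

theorem exists_summandOfMultiple_of_projective [IsNoetherianRing S] (M : ℕ → Type*)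
    [∀ n, AddCommGroup (M n)] [∀ n, Module S (M n)] [∀ n, Module.Finite S (M n)]
    [∀ n, Module.Projective S (M n)] (p : ∀ n, M (n + 1) →ₗ[S] M n)
    (hp : ∀ n, Function.Surjective (p n)) : ∃ n, SummandOfMultiple S (M (n + 1)) (M n) := by
  let I : ℕ →o Ideal S := ⟨fun n => traceSubmodule S S (M n),
    monotone_nat_of_le_succ fun n => traceSubmodule_le_of_surjective (p n) (hp n)⟩
  obtain ⟨n, hn⟩ := monotone_stabilizes_iff_noetherian.mpr ‹IsNoetherianRing S› I
  have hI : I (n + 1) ≤ I n := (hn (n + 1) n.le_succ).ge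
  exact ⟨n, summandOfMultiple_of_projective (traceSubmodule_eq_top_of_projective hI)⟩

end Projective

section Semisimple

variable {S : Type*} [Ring S]

theorem exists_comp_eq_of_ker_le {M N P : Type*} [AddCommGroup M] [Module S M]
    [AddCommGroup N] [Module S N] [AddCommGroup P] [Module S P] [IsSemisimpleModule S N]
    (f : M →ₗ[S] N) (g : M →ₗ[S] P) (h : LinearMap.ker f ≤ LinearMap.ker g) :
    ∃ θ : N →ₗ[S] P, θ ∘ₗ f = g := by
  obtain ⟨θ, hθ⟩ := IsSemisimpleModule.extension_property ((LinearMap.ker f).liftQ f le_rfl)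
    (LinearMap.ker_eq_bot.mp (Submodule.ker_liftQ_eq_bot' _ _ rfl)) ((LinearMap.ker f).liftQ g h)
  refine ⟨θ, ?_⟩
  rw [← (LinearMap.ker f).liftQ_mkQ f le_rfl, ← LinearMap.comp_assoc, hθ, Submodule.liftQ_mkQ]

theorem exists_finset_mem_annihilator_of_forall_smul_eq_zero [IsArtinianRing S] (N : Type*)
    [AddCommGroup N] [Module S N] :
    ∃ s : Finset N, ∀ a : S, (∀ x ∈ s, a • x = 0) → a ∈ Module.annihilator S N := by
  classical
  let J (s : Finset N) : Ideal S := ⨅ x ∈ s, LinearMap.ker (LinearMap.toSpanSingleton S N x)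
  have mem_J : ∀ s a, a ∈ J s ↔ ∀ x ∈ s, a • x = 0 := by simp [J]
  obtain ⟨_, ⟨s, rfl⟩, hmin⟩ := IsArtinian.set_has_minimal (Set.range J) ⟨_, ∅, rfl⟩
  refine ⟨s, fun a ha => Module.mem_annihilator.mpr fun x => ?_⟩
  have hle : J (insert x s) ≤ J s := iInf_le_iInf_of_subset (Finset.subset_insert x s)
  have heq : J s = J (insert x s) := (eq_of_le_of_not_lt hle (hmin _ ⟨_, rfl⟩)).symm
  rw [← mem_J, heq, mem_J] at ha
  exact ha x (Finset.mem_insert_self x s)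

-- As `S` is Artinian, `S / ann N` embeds into a finite power of `N`; as `N` is semisimple, any
-- map out of `S / ann N` extends to that power.
theorem traceSubmodule_eq_top_of_annihilator_le [IsArtinianRing S] {M N : Type*} [AddCommGroup M]
    [Module S M] [AddCommGroup N] [Module S N] [IsSemisimpleModule S N]
    (h : Module.annihilator S N ≤ Module.annihilator S M) : traceSubmodule S M N = ⊤ := by
  classical
  refine eq_top_iff.mpr fun m _ => ?_
  obtain ⟨s, hs⟩ := exists_finset_mem_annihilator_of_forall_smul_eq_zero (S := S) N
  let ψ : S →ₗ[S] (s → N) := LinearMap.pi fun x => LinearMap.toSpanSingleton S N x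
  let φ : S →ₗ[S] M := LinearMap.toSpanSingleton S M m
  have hker : LinearMap.ker ψ ≤ LinearMap.ker φ := fun a ha =>
    Module.mem_annihilator.mp
      (h (hs a fun x hx => congrFun (LinearMap.mem_ker.mp ha) ⟨x, hx⟩)) m
  obtain ⟨θ, hθ⟩ := exists_comp_eq_of_ker_le ψ φ hker
  have hm : θ (ψ 1) = m := (LinearMap.congr_fun hθ 1).trans (one_smul S m)
  rw [← hm, ← Finset.univ_sum_single (ψ 1), map_sum]
  exact Submodule.sum_mem _ fun x _ =>
    apply_mem_traceSubmodule (θ ∘ₗ LinearMap.single S (fun _ => N) x) (ψ 1 x)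

theorem exists_summandOfMultiple_of_isSemisimpleModule [IsArtinianRing S] (M : ℕ → Type*)
    [∀ n, AddCommGroup (M n)] [∀ n, Module S (M n)] [∀ n, Module.Finite S (M n)]
    [∀ n, IsSemisimpleModule S (M n)] (p : ∀ n, M (n + 1) →ₗ[S] M n)
    (hp : ∀ n, Function.Surjective (p n)) : ∃ n, SummandOfMultiple S (M (n + 1)) (M n) := by
  let I : ℕ →o (Ideal S)ᵒᵈ := ⟨fun n => OrderDual.toDual (Module.annihilator S (M n)),
    monotone_nat_of_le_succ fun n => (p n).annihilator_le_of_surjective (hp n)⟩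
  obtain ⟨n, hn⟩ := IsArtinian.monotone_stabilizes I
  have hI : Module.annihilator S (M n) ≤ Module.annihilator S (M (n + 1)) :=
    (congrArg OrderDual.ofDual (hn (n + 1) n.le_succ)).le
  exact ⟨n, summandOfMultiple_of_isSemisimpleModule (traceSubmodule_eq_top_of_annihilator_le hI)⟩

end Semisimple

section FiniteRepresentationType

theorem exists_isCompl_of_not_isIndecomposable {S : Type v} [Ring S] {M : Type u} [AddCommGroup M]
    [Module S M] {X : Submodule S M} (hX : X ≠ ⊥) (hind : ¬ IsIndecomposable S X) :
    ∃ Y Z : Submodule S M, Y < X ∧ Z < X ∧ Disjoint Y Z ∧ Y ⊔ Z = X := by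
  have := Submodule.nontrivial_iff_ne_bot.mpr hX
  simp only [IsIndecomposable, this, true_and, not_forall, not_or] at hind
  obtain ⟨N, P, hNP, hN, hP⟩ := hind
  have map_lt : ∀ {N P : Submodule S X}, IsCompl N P → P ≠ ⊥ → N.map X.subtype < X := by
    intro N P hNP hP
    have hN : N < ⊤ := lt_top_iff_ne_top.mpr fun hN => hP (by simpa [hN] using hNP.inf_eq_bot)
    simpa using Submodule.map_strictMono_of_injective X.injective_subtype hN
  refine ⟨N.map X.subtype, P.map X.subtype, map_lt hNP hP, map_lt hNP.symm hN,
    Submodule.disjoint_map X.injective_subtype hNP.disjoint, ?_⟩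
  rw [← Submodule.map_sup, hNP.sup_eq_top, Submodule.map_subtype_top]

theorem exists_finset_supIndep_isIndecomposable {S : Type v} [Ring S] {M : Type u}
    [AddCommGroup M] [Module S M] [IsArtinian S M] (X : Submodule S M) :
    ∃ s : Finset (Submodule S M),
      s.SupIndep id ∧ s.sup id = X ∧ ∀ Y ∈ s, IsIndecomposable S Y := by
  classical
  induction X using WellFoundedLT.induction with
  | ind X ih =>
  by_cases hX : X = ⊥
  · exact ⟨∅, Finset.supIndep_empty _, by simp [hX], by simp⟩
  by_cases hind : IsIndecomposable S X
  · exact ⟨{X}, Finset.supIndep_singleton _ _, by simp, by simpa using hind⟩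
  obtain ⟨Y, Z, hY, hZ, hYZ, rfl⟩ := exists_isCompl_of_not_isIndecomposable hX hind
  obtain ⟨s, hs, hsY, hs_ind⟩ := ih Y hY
  obtain ⟨t, ht, htZ, ht_ind⟩ := ih Z hZ
  refine ⟨s ∪ t, hs.union ht (by rwa [hsY, htZ]), by rw [Finset.sup_union, hsY, htZ], ?_⟩
  simp only [Finset.mem_union]
  rintro W (hW | hW)
  exacts [hs_ind W hW, ht_ind W hW]

theorem exists_isIndecomposable_decomposition (S : Type v) [Ring S] (M : Type u)
    [AddCommGroup M] [Module S M] [IsArtinian S M] :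
    ∃ (s : Finset (Submodule S M)) (p : ∀ X : s, M →ₗ[S] X.1),
      ∑ X, X.1.subtype ∘ₗ p X = LinearMap.id ∧ (∀ X, p X ∘ₗ X.1.subtype = LinearMap.id) ∧
        ∀ X : s, IsIndecomposable S X.1 := by
  classical
  obtain ⟨s, hs, hsM, hind⟩ := exists_finset_supIndep_isIndecomposable (⊤ : Submodule S M)
  have hint : DirectSum.IsInternal (fun X : s => X.1) :=
    DirectSum.isInternal_submodule_of_iSupIndep_of_iSup_eq_top hs.independent
      (by rw [← hsM, Finset.sup_id_eq_sSup, sSup_eq_iSup']; rfl)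
  let e := LinearEquiv.ofBijective (DirectSum.coeLinearMap fun X : s => X.1) hint
  refine ⟨s, fun X => DirectSum.component S s (fun X => X.1) X ∘ₗ e.symm.toLinearMap,
    LinearMap.ext fun x => ?_, fun X => LinearMap.ext hint.ofBijective_coeLinearMap_same,
    fun X => hind X X.2⟩
  have hx := congrArg (DirectSum.coeLinearMap fun X : s => X.1) (DirectSum.sum_univ_of (e.symm x))
  simp only [map_sum, DirectSum.coeLinearMap_of] at hx
  rw [LinearMap.sum_apply]
  exact hx.trans (e.apply_symm_apply x)

variable {A : Type u} [Ring A] {T : Type*} [Ring T] [SMul T Aᵐᵒᵖ]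

-- Along the sequence, the set of indecomposables which occur in a multiple of `M n` over `T`
-- increases, and it is a subset of a finite set.
theorem exists_summandOfMultiple_of_finiteRepresentationType (hA : FiniteRepresentationType A)
    (M : ℕ → Type u) [∀ n, AddCommGroup (M n)] [∀ n, Module Aᵐᵒᵖ (M n)] [∀ n, Module T (M n)]
    [∀ n, IsScalarTower T Aᵐᵒᵖ (M n)] [IsArtinianRing Aᵐᵒᵖ] [∀ n, Module.Finite Aᵐᵒᵖ (M n)]
    (h : ∀ n, SummandOfMultiple T (M n) (M (n + 1))) :
    ∃ n, SummandOfMultiple T (M (n + 1)) (M n) := by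
  obtain ⟨t, F, hF⟩ := hA
  let I : ℕ →o Set (Fin t) := ⟨fun n => {i | ∃ (m : ℕ) (X : Submodule Aᵐᵒᵖ (M m)),
      Nonempty (X ≃ₗ[Aᵐᵒᵖ] F i) ∧ SummandOfMultiple T X (M n)},
    monotone_nat_of_le_succ fun n i ⟨m, X, hX, hXM⟩ => ⟨m, X, hX, hXM.trans (h n)⟩⟩
  obtain ⟨n, hn⟩ := WellFoundedGT.monotone_chain_condition I
  have hI : I (n + 1) ≤ I n := (hn (n + 1) n.le_succ).ge
  obtain ⟨s, p, hp, hretract, hind⟩ := exists_isIndecomposable_decomposition Aᵐᵒᵖ (M (n + 1))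
  have hid : ∑ X : s, X.1.subtype.restrictScalars T ∘ₗ (p X).restrictScalars T = LinearMap.id :=
    LinearMap.ext fun x => by simpa using LinearMap.congr_fun hp x
  refine ⟨n, .of_sum_comp_eq_id (fun X => (p X).restrictScalars T) _ hid fun X => ?_⟩
  have : Module.Finite Aᵐᵒᵖ X.1 :=
    .of_surjective (p X) fun x => ⟨x, LinearMap.congr_fun (hretract X) x⟩
  obtain ⟨i, ⟨e⟩⟩ := hF X.1 (hind X)
  have hX : SummandOfMultiple T X.1 (M (n + 1)) :=
    .of_retract (X.1.subtype.restrictScalars T) ((p X).restrictScalars T)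
      (LinearMap.ext fun x => LinearMap.congr_fun (hretract X) x)
  obtain ⟨m, Y, ⟨e'⟩, hY⟩ := hI ⟨n + 1, X.1, ⟨e⟩, hX⟩
  exact .trans (.of_equiv ((e.trans e'.symm).restrictScalars T)) hY

end FiniteRepresentationType

end Towers

/-! ### Diagonal actions on tensor products -/

section OrbitMap

variable {k A B C M N : Type*} [CommSemiring k] [Semiring A] [Algebra k A] [Semiring B]
  [Algebra k B] [AddCommMonoid C] [Module k C] [AddCommMonoid M] [Module k M] [AddCommMonoid N]
  [Module k N] [Module Aᵐᵒᵖ N] [IsScalarTower k Aᵐᵒᵖ N]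

variable (k A) in
/-- The orbit map `a ↦ n a` of an element `n` of a right `A`-module. The diagonal action on pure
tensors is expressed through it, which replaces Sweedler notation: `(m ⊗ n) a` is the image of
`Δ a` under the tensor product of the orbit maps of `m` and `n`. -/
def orbitMap : N →ₗ[k] A →ₗ[k] N :=
  ((Algebra.lsmul k k N).toLinearMap ∘ₗ (opLinearEquiv k).toLinearMap).flip

theorem comp_orbitMap_comp [Module Bᵐᵒᵖ M] [IsScalarTower k Bᵐᵒᵖ M] {φ : M →ₗ[k] N}
    {f : C →ₗ[k] B} {g : C →ₗ[k] A} (h : ∀ c m, φ (op (f c) • m) = op (g c) • φ m) (m : M) :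
    φ ∘ₗ orbitMap k B m ∘ₗ f = orbitMap k A (φ m) ∘ₗ g :=
  LinearMap.ext fun c => h c m

end OrbitMap

/-- A `k`-linear map commuting with the right actions of `A`, as a homomorphism of right
`A`-modules. -/
def rightLinearMap {k A M N : Type*} [Semiring k] [Semiring A] [AddCommMonoid M] [Module k M]
    [Module Aᵐᵒᵖ M] [AddCommMonoid N] [Module k N] [Module Aᵐᵒᵖ N] (φ : M →ₗ[k] N)
    (h : ∀ (a : A) m, φ (op a • m) = op a • φ m) : M →ₗ[Aᵐᵒᵖ] N where
  toFun := φ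
  map_add' := φ.map_add
  map_smul' a m := h a.unop m

theorem map_toSpanSingleton_comp_counit_comul {k C X Y : Type*} [CommSemiring k]
    [AddCommMonoid C] [Module k C] [Coalgebra k C] [AddCommMonoid X] [Module k X]
    [AddCommMonoid Y] [Module k Y] (f : C →ₗ[k] X) (y : Y) (c : C) :
    TensorProduct.map f (LinearMap.toSpanSingleton k Y y ∘ₗ counit) (comul c) = f c ⊗ₜ[k] y := by
  have h := congrArg (TensorProduct.map f (LinearMap.toSpanSingleton k Y y))
    (lTensor_counit_comul (R := k) c)
  rwa [LinearMap.map_lTensor, TensorProduct.map_tmul, LinearMap.toSpanSingleton_apply,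
    one_smul] at h

namespace RightTensor

section Linear

variable {k : Type v} [Field k] {M N M' N' : Type u}
  [AddCommGroup M] [Module k M] [AddCommGroup N] [Module k N]
  [AddCommGroup M'] [Module k M'] [AddCommGroup N'] [Module k N']

variable (k M N) in
/-- The identification of `M ⊗ N` with the type synonym carrying the diagonal action. -/
def of : M ⊗[k] N ≃ₗ[k] RightTensor k M N :=
  LinearEquiv.refl k (M ⊗[k] N)

@[elab_as_elim]
theorem induction_on {p : RightTensor k M N → Prop} (x : RightTensor k M N)
    (tmul : ∀ m n, p (of k M N (m ⊗ₜ n))) (add : ∀ x y, p x → p y → p (x + y)) : p x := by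
  obtain ⟨x, rfl⟩ := (of k M N).surjective x
  induction x with
  | zero => simpa only [TensorProduct.tmul_zero] using tmul 0 0
  | tmul m n => exact tmul m n
  | add x y hx hy => exact (map_add (of k M N) x y).symm ▸ add _ _ hx hy

theorem hom_ext {X : Type*} [AddCommGroup X] [Module k X] {f g : RightTensor k M N →ₗ[k] X}
    (h : ∀ m n, f (of k M N (m ⊗ₜ n)) = g (of k M N (m ⊗ₜ n))) : f = g :=
  LinearMap.ext fun x => by
    induction x using induction_on with
    | tmul m n => exact h m n
    | add x y hx hy => rw [map_add, map_add, hx, hy]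

/-- The tensor product of two linear maps. -/
def map (φ : M →ₗ[k] M') (ψ : N →ₗ[k] N') : RightTensor k M N →ₗ[k] RightTensor k M' N' :=
  (of k M' N').toLinearMap ∘ₗ TensorProduct.map φ ψ ∘ₗ (of k M N).symm.toLinearMap

theorem map_of (φ : M →ₗ[k] M') (ψ : N →ₗ[k] N') (x : M ⊗[k] N) :
    map φ ψ (of k M N x) = of k M' N' (TensorProduct.map φ ψ x) := rfl

variable (k M N) in
/-- The associativity isomorphism `(M ⊗ N) ⊗ P ≅ M ⊗ (N ⊗ P)`. -/
def assoc (P : Type u) [AddCommGroup P] [Module k P] :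
    RightTensor k (RightTensor k M N) P ≃ₗ[k] RightTensor k M (RightTensor k N P) :=
  (of k (RightTensor k M N) P).symm ≪≫ₗ TensorProduct.congr (of k M N).symm (.refl k P) ≪≫ₗ
    TensorProduct.assoc k M N P ≪≫ₗ TensorProduct.congr (.refl k M) (of k N P) ≪≫ₗ
      of k M (RightTensor k N P)

end Linear

section Action

variable {k : Type v} [Field k] {A B : Type u} [Ring A] [Bialgebra k A] [Ring B] [Bialgebra k B]
  {C : Type*} [AddCommMonoid C] [Module k C] [Coalgebra k C] {M N M' N' P : Type u}
  [AddCommGroup M] [Module k M] [Module Aᵐᵒᵖ M] [IsScalarTower k Aᵐᵒᵖ M]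
  [AddCommGroup N] [Module k N] [Module Aᵐᵒᵖ N] [IsScalarTower k Aᵐᵒᵖ N]
  [AddCommGroup M'] [Module k M'] [Module Bᵐᵒᵖ M'] [IsScalarTower k Bᵐᵒᵖ M']
  [AddCommGroup N'] [Module k N'] [Module Bᵐᵒᵖ N'] [IsScalarTower k Bᵐᵒᵖ N']
  [AddCommGroup P] [Module k P] [Module Aᵐᵒᵖ P] [IsScalarTower k Aᵐᵒᵖ P]

instance : IsScalarTower k Aᵐᵒᵖ (RightTensor k M N) :=
  ⟨fun t a x => LinearMap.congr_fun (map_smul (diagonalAction k A M N) t a) ((of k M N).symm x)⟩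

theorem op_smul_of_tmul (a : A) (m : M) (n : N) :
    op a • of k M N (m ⊗ₜ n) =
      of k M N (TensorProduct.map (orbitMap k A m) (orbitMap k A n) (comul a)) := by
  suffices h : ∀ z : A ⊗[k] A, Module.endTensorEndAlgHom (R := k) (S := k) (A := k)
      (Algebra.TensorProduct.map (Algebra.lsmul k k M) (Algebra.lsmul k k N)
        ((Algebra.TensorProduct.opAlgEquiv k k A A).symm (op z))) (m ⊗ₜ n) =
      TensorProduct.map (orbitMap k A m) (orbitMap k A n) z from h (comul a)
  intro z
  induction z with
  | zero => simp only [op_zero, map_zero, LinearMap.zero_apply]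
  | add z w hz hw => simp only [op_add, map_add, LinearMap.add_apply, hz, hw]
  | tmul a b => rfl

theorem op_smul_of_tmul_apply (f : C →ₗc[k] A) (c : C) (m : M) (n : N) :
    op (f c) • of k M N (m ⊗ₜ n) = of k M N (TensorProduct.map
      (orbitMap k A m ∘ₗ f.toLinearMap) (orbitMap k A n ∘ₗ f.toLinearMap) (comul c)) := by
  rw [op_smul_of_tmul, TensorProduct.map_comp, LinearMap.comp_apply]
  exact congrArg _ (congrArg _ (LinearMap.congr_fun f.map_comp_comul c).symm)

theorem map_op_smul (f : C →ₗc[k] B) (g : C →ₗc[k] A) {φ : M' →ₗ[k] M} {ψ : N' →ₗ[k] N}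
    (hφ : ∀ c m, φ (op (f c) • m) = op (g c) • φ m)
    (hψ : ∀ c n, ψ (op (f c) • n) = op (g c) • ψ n) (c : C) (x : RightTensor k M' N') :
    map φ ψ (op (f c) • x) = op (g c) • map φ ψ x := by
  induction x using induction_on with
  | add x y hx hy => simp only [smul_add, map_add, hx, hy]
  | tmul m n =>
    rw [op_smul_of_tmul_apply, map_of, map_of, TensorProduct.map_tmul, op_smul_of_tmul_apply,
      ← LinearMap.comp_apply, ← TensorProduct.map_comp,
      comp_orbitMap_comp (f := f.toLinearMap) (g := g.toLinearMap) hφ,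
      comp_orbitMap_comp (f := f.toLinearMap) (g := g.toLinearMap) hψ]

theorem op_smul_of_tmul_of_invariant (f : C →ₗc[k] A) {n : N}
    (hn : ∀ c, op (f c) • n = counit (R := k) c • n) (c : C) (m : M) :
    op (f c) • of k M N (m ⊗ₜ n) = of k M N ((op (f c) • m) ⊗ₜ n) := by
  have horbit : orbitMap k A n ∘ₗ f.toLinearMap = LinearMap.toSpanSingleton k N n ∘ₗ counit :=
    LinearMap.ext hn
  rw [op_smul_of_tmul_apply, horbit, map_toSpanSingleton_comp_counit_comul]
  rfl

/-- The projection `m ⊗ n ↦ θ(n) m` given by an invariant linear form `θ` on `N`. -/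
def proj (θ : N →ₗ[k] k) (hθ : ∀ (a : A) n, θ (op a • n) = counit a * θ n) :
    RightTensor k M N →ₗ[Aᵐᵒᵖ] M :=
  rightLinearMap ((TensorProduct.rid k M).toLinearMap ∘ₗ TensorProduct.map LinearMap.id θ ∘ₗ
    (of k M N).symm.toLinearMap) fun a x => by
      induction x using induction_on with
      | add x y hx hy => simp only [smul_add, map_add, hx, hy]
      | tmul m n =>
        have horbit : θ ∘ₗ orbitMap k A n = LinearMap.toSpanSingleton k k (θ n) ∘ₗ counit :=
          LinearMap.ext fun a => hθ a n
        rw [op_smul_of_tmul]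
        simp only [LinearMap.comp_apply, LinearEquiv.coe_coe, LinearEquiv.symm_apply_apply,
          TensorProduct.map_map, LinearMap.id_comp, horbit,
          map_toSpanSingleton_comp_counit_comul, TensorProduct.map_tmul, TensorProduct.rid_tmul,
          LinearMap.id_apply]
        exact smul_comm (θ n) (op a) m

theorem proj_of_tmul (θ : N →ₗ[k] k) (hθ : ∀ (a : A) n, θ (op a • n) = counit a * θ n) (m : M)
    (n : N) : proj θ hθ (of k M N (m ⊗ₜ n)) = θ n • m := rfl

theorem orbitMap_of_tmul (m : M) (n : N) : orbitMap k A (of k M N (m ⊗ₜ n)) =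
    (of k M N).toLinearMap ∘ₗ
      TensorProduct.map (orbitMap k A m) (orbitMap k A n) ∘ₗ comul :=
  LinearMap.ext fun a => op_smul_of_tmul a m n

theorem assoc_op_smul (a : A) (x : RightTensor k (RightTensor k M N) P) :
    assoc k M N P (op a • x) = op a • assoc k M N P x := by
  suffices h : (assoc k M N P).toLinearMap ∘ₗ (Algebra.lsmul k k _ (op a)) =
      (Algebra.lsmul k k _ (op a)) ∘ₗ (assoc k M N P).toLinearMap from LinearMap.congr_fun h x
  refine hom_ext fun y p => ?_
  induction y using induction_on with
  | add y z hy hz => simp only [TensorProduct.add_tmul, map_add, hy, hz]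
  | tmul m n =>
    set f := orbitMap k A m
    set g := orbitMap k A n
    set h := orbitMap k A p
    have hassoc : (assoc k M N P).toLinearMap ∘ₗ (of k _ P).toLinearMap ∘ₗ
          TensorProduct.map ((of k M N).toLinearMap ∘ₗ TensorProduct.map f g) h =
        (of k M _).toLinearMap ∘ₗ
          TensorProduct.map f ((of k N P).toLinearMap ∘ₗ TensorProduct.map g h) ∘ₗ
            (TensorProduct.assoc k A A A).toLinearMap :=
      TensorProduct.ext_threefold fun _ _ _ => rfl
    change assoc k M N P (op a • of k _ P (of k M N (m ⊗ₜ n) ⊗ₜ p)) =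
      op a • of k M _ (m ⊗ₜ of k N P (n ⊗ₜ p))
    rw [op_smul_of_tmul, op_smul_of_tmul, orbitMap_of_tmul, orbitMap_of_tmul,
      ← LinearMap.comp_assoc, ← LinearMap.comp_assoc, ← LinearMap.map_rTensor,
      ← LinearMap.map_lTensor, ← coassoc_apply]
    exact LinearMap.congr_fun hassoc _

theorem finite_rightTensor [Module.Finite k M] [Module.Finite k N] :
    Module.Finite k (RightTensor k M N) :=
  Module.Finite.equiv (of k M N)

end Action

section Hom

variable {k : Type v} [Field k] {A : Type u} [Ring A] [Bialgebra k A] {M N M' N' : Type u}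
  [AddCommGroup M] [Module k M] [Module Aᵐᵒᵖ M] [IsScalarTower k Aᵐᵒᵖ M]
  [AddCommGroup N] [Module k N] [Module Aᵐᵒᵖ N] [IsScalarTower k Aᵐᵒᵖ N]
  [AddCommGroup M'] [Module k M'] [Module Aᵐᵒᵖ M'] [IsScalarTower k Aᵐᵒᵖ M']
  [AddCommGroup N'] [Module k N'] [Module Aᵐᵒᵖ N'] [IsScalarTower k Aᵐᵒᵖ N']

/-- The tensor product of two homomorphisms of right modules. -/
def mapHom (φ : M →ₗ[Aᵐᵒᵖ] M') (ψ : N →ₗ[Aᵐᵒᵖ] N') :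
    RightTensor k M N →ₗ[Aᵐᵒᵖ] RightTensor k M' N' :=
  rightLinearMap (map (φ.restrictScalars k) (ψ.restrictScalars k))
    (map_op_smul (.id k A) (.id k A) (fun a m => φ.map_smul (op a) m)
      fun a n => ψ.map_smul (op a) n)

theorem mapHom_of_tmul (φ : M →ₗ[Aᵐᵒᵖ] M') (ψ : N →ₗ[Aᵐᵒᵖ] N') (m : M) (n : N) :
    mapHom φ ψ (of k M N (m ⊗ₜ n)) = of k M' N' (φ m ⊗ₜ ψ n) := rfl

variable (k M) in
theorem summandOfMultiple_of_right (h : SummandOfMultiple Aᵐᵒᵖ N N') :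
    SummandOfMultiple Aᵐᵒᵖ (RightTensor k M N) (RightTensor k M N') := by
  obtain ⟨q, f, g, hfg⟩ := h
  refine ⟨q, fun i => mapHom LinearMap.id (f i), fun i => mapHom LinearMap.id (g i),
    LinearMap.ext fun x => ?_⟩
  induction x using induction_on with
  | add x y hx hy => rw [map_add, map_add, hx, hy]
  | tmul m n =>
    have hn : ∑ i, g i (f i n) = n := by
      simpa only [LinearMap.sum_apply, LinearMap.comp_apply, LinearMap.id_apply] using
        LinearMap.congr_fun hfg n
    simp only [LinearMap.sum_apply, LinearMap.comp_apply, mapHom_of_tmul, LinearMap.id_apply,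
      ← map_sum, ← TensorProduct.tmul_sum, hn]

theorem iSup_range_mapHom_subtype {ι κ : Type*} {X : ι → Submodule Aᵐᵒᵖ M}
    {Y : κ → Submodule Aᵐᵒᵖ N} (hX : ⨆ i, X i = ⊤) (hY : ⨆ j, Y j = ⊤) :
    ⨆ p : ι × κ, LinearMap.range (mapHom (k := k) (X p.1).subtype (Y p.2).subtype) = ⊤ := by
  refine eq_top_iff.mpr fun x _ => ?_
  induction x using induction_on with
  | add x y hx hy => exact add_mem (hx trivial) (hy trivial)
  | tmul m n =>
    refine Submodule.iSup_induction X (motive := fun m => of k M N (m ⊗ₜ n) ∈ _)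
      (hX ▸ Submodule.mem_top) (fun i m hm => ?_)
      (by rw [TensorProduct.zero_tmul, map_zero]; exact zero_mem _)
      fun m m' hm hm' => by rw [TensorProduct.add_tmul, map_add]; exact add_mem hm hm'
    refine Submodule.iSup_induction Y (motive := fun n => of k M N (m ⊗ₜ n) ∈ _)
      (hY ▸ Submodule.mem_top) (fun j n hn => ?_)
      (by rw [TensorProduct.tmul_zero, map_zero]; exact zero_mem _)
      fun n n' hn hn' => by rw [TensorProduct.tmul_add, map_add]; exact add_mem hn hn'
    exact Submodule.mem_iSup_of_mem (i, j)
      ⟨of k _ _ ((⟨m, hm⟩ : X i) ⊗ₜ (⟨n, hn⟩ : Y j)), rfl⟩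

theorem isSemisimpleModule (hA : ChevalleyProperty k A) [IsSemisimpleModule Aᵐᵒᵖ M]
    [IsSemisimpleModule Aᵐᵒᵖ N] : IsSemisimpleModule Aᵐᵒᵖ (RightTensor k M N) := by
  have hrange (p : {X : Submodule Aᵐᵒᵖ M // IsSimpleModule Aᵐᵒᵖ X} ×
      {Y : Submodule Aᵐᵒᵖ N // IsSimpleModule Aᵐᵒᵖ Y}) : IsSemisimpleModule Aᵐᵒᵖ
        (LinearMap.range (mapHom (k := k) p.1.1.subtype p.2.1.subtype)) :=
    have := hA p.1.1 p.2.1 p.1.2 p.2.2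
    IsSemisimpleModule.range _
  refine isSemisimpleModule_of_isSemisimpleModule_submodule' hrange
    (iSup_range_mapHom_subtype
      ((sSup_eq_iSup' _).symm.trans (IsSemisimpleModule.sSup_simples_eq_top Aᵐᵒᵖ M))
      ((sSup_eq_iSup' _).symm.trans (IsSemisimpleModule.sSup_simples_eq_top Aᵐᵒᵖ N)))

end Hom

/-! ### The tensor product with the regular module is free -/

section Shear

variable {k : Type v} [Field k] {A M : Type u} [Ring A] [Bialgebra k A]
  [AddCommGroup M] [Module k M] [Module Aᵐᵒᵖ M] [IsScalarTower k Aᵐᵒᵖ M]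

variable (M) in
/-- The endomorphism `m ⊗ h ↦ m f(h₍₁₎) ⊗ h₍₂₎`. -/
def shear (f : A →ₗ[k] A) : M ⊗[k] A →ₗ[k] M ⊗[k] A :=
  (TensorProduct.lift (orbitMap k A)).rTensor A ∘ₗ
    (TensorProduct.assoc k M A A).symm.toLinearMap ∘ₗ (f.rTensor A ∘ₗ comul).lTensor M

theorem shear_tmul (f : A →ₗ[k] A) (m : M) (h : A) :
    shear M f (m ⊗ₜ h) = TensorProduct.map (orbitMap k A m ∘ₗ f) LinearMap.id (comul h) := by
  have hassoc : (TensorProduct.lift (orbitMap k A)).rTensor A ∘ₗ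
      (TensorProduct.assoc k M A A).symm.toLinearMap ∘ₗ TensorProduct.mk k M (A ⊗[k] A) m =
        (orbitMap k A m).rTensor A := TensorProduct.ext' fun _ _ => rfl
  refine (LinearMap.congr_fun hassoc (f.rTensor A (comul h))).trans ?_
  rw [← LinearMap.comp_apply, ← LinearMap.rTensor_comp, LinearMap.rTensor]

theorem shear_comp_shear (f g : A →ₗ[k] A) :
    shear M f ∘ₗ shear M g = shear M (LinearMap.mul' k A ∘ₗ TensorProduct.map g f ∘ₗ comul) := by
  refine TensorProduct.ext' fun m h => ?_
  let μ := orbitMap k A m ∘ₗ LinearMap.mul' k A ∘ₗ TensorProduct.map g f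
  have hassoc : TensorProduct.map μ LinearMap.id ∘ₗ
      (TensorProduct.assoc k A A A).symm.toLinearMap ∘ₗ comul.lTensor A =
        shear M f ∘ₗ TensorProduct.map (orbitMap k A m ∘ₗ g) LinearMap.id := by
    refine TensorProduct.ext' fun a b => ?_
    have hmul : TensorProduct.map μ LinearMap.id ∘ₗ
        (TensorProduct.assoc k A A A).symm.toLinearMap ∘ₗ TensorProduct.mk k A (A ⊗[k] A) a =
          TensorProduct.map (orbitMap k A (orbitMap k A m (g a)) ∘ₗ f) LinearMap.id :=
      TensorProduct.ext' fun p q =>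
        congrArg (· ⊗ₜ[k] q) (mul_smul (op (f p)) (op (g a)) m)
    exact (LinearMap.congr_fun hmul (comul b)).trans (shear_tmul f _ b).symm
  rw [LinearMap.comp_apply, shear_tmul, shear_tmul, ← LinearMap.comp_apply, ← hassoc]
  simp only [LinearMap.comp_apply, LinearEquiv.coe_coe, coassoc_symm_apply, LinearMap.map_rTensor]
  rfl

theorem shear_algebraMap_comp_counit :
    shear M (Algebra.linearMap k A ∘ₗ counit) = LinearMap.id := by
  refine TensorProduct.ext' fun m h => ?_
  have horbit : orbitMap k A m ∘ₗ Algebra.linearMap k A = LinearMap.toSpanSingleton k M m :=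
    LinearMap.ext fun t => algebraMap_smul Aᵐᵒᵖ t m
  rw [shear_tmul, ← LinearMap.comp_assoc, horbit, ← LinearMap.map_rTensor, rTensor_counit_comul,
    TensorProduct.map_tmul, LinearMap.toSpanSingleton_apply, one_smul]
  rfl

end Shear

section Free

variable {k : Type v} [Field k] {A M : Type u} [Ring A] [HopfAlgebra k A]
  [AddCommGroup M] [Module k M] [Module Aᵐᵒᵖ M] [IsScalarTower k Aᵐᵒᵖ M]

variable (k A M) in
/-- The isomorphism `m ⊗ h ↦ (m ⊗ 1) h` from `M ⊗ A`, where `A` acts on the second factor, to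
`M ⊗ A` with the diagonal action. Its inverse is `m ⊗ h ↦ m S(h₍₁₎) ⊗ h₍₂₎`. -/
def freeEquiv : M ⊗[k] A ≃ₗ[k] RightTensor k M A :=
  LinearEquiv.ofLinearMap (shear M LinearMap.id) (shear M (HopfAlgebra.antipode k))
    (by rw [shear_comp_shear, ← LinearMap.rTensor, HopfAlgebra.mul_antipode_rTensor_comul,
      shear_algebraMap_comp_counit])
    (by rw [shear_comp_shear, ← LinearMap.lTensor, HopfAlgebra.mul_antipode_lTensor_comul,
      shear_algebraMap_comp_counit]) ≪≫ₗ of k M A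

theorem freeEquiv_tmul (m : M) (h : A) :
    freeEquiv k A M (m ⊗ₜ h) = op h • of k M A (m ⊗ₜ 1) := by
  have horbit : orbitMap k A (1 : A) = LinearMap.id := LinearMap.ext one_mul
  rw [op_smul_of_tmul, horbit]
  exact congrArg (of k M A) (shear_tmul LinearMap.id m h)

theorem freeEquiv_tmul_mul (m : M) (h a : A) :
    freeEquiv k A M (m ⊗ₜ (h * a)) = op a • freeEquiv k A M (m ⊗ₜ h) := by
  rw [freeEquiv_tmul, freeEquiv_tmul, op_mul, mul_smul]

theorem hom_ext_of_tmul_one {X : Type*} [AddCommGroup X] [Module k X] [Module Aᵐᵒᵖ X]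
    {φ ψ : RightTensor k M A →ₗ[Aᵐᵒᵖ] X}
    (h : ∀ m, φ (of k M A (m ⊗ₜ 1)) = ψ (of k M A (m ⊗ₜ 1))) : φ = ψ := by
  refine LinearMap.ext fun x => ?_
  obtain ⟨x, rfl⟩ := (freeEquiv k A M).surjective x
  induction x with
  | zero => simp only [map_zero]
  | add x y hx hy => simp only [map_add, hx, hy]
  | tmul m a => rw [freeEquiv_tmul, map_smul, map_smul, h]

theorem freeEquiv_symm_of_tmul (m : M) (h : A) :
    (freeEquiv k A M).symm (of k M A (m ⊗ₜ h)) =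
      TensorProduct.map (orbitMap k A m ∘ₗ HopfAlgebra.antipode k) LinearMap.id (comul h) :=
  shear_tmul _ m h

variable (k A M) in
theorem summandOfMultiple_self [Module.Finite k M] :
    SummandOfMultiple Aᵐᵒᵖ (RightTensor k M A) A := by
  let b := Module.finBasis k M
  let e := TensorProduct.equivFinsuppOfBasisLeft (N := A) b
  let c (i) : M ⊗[k] A →ₗ[k] A := Finsupp.lapply i ∘ₗ e.toLinearMap
  have hc (i) (a : A) (x : RightTensor k M A) : c i ((freeEquiv k A M).symm (op a • x)) =
      op a • c i ((freeEquiv k A M).symm x) := by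
    obtain ⟨x, rfl⟩ := (freeEquiv k A M).surjective x
    induction x with
    | zero => simp only [map_zero, smul_zero]
    | add x y hx hy => simp only [map_add, smul_add, hx, hy]
    | tmul m h =>
      rw [← freeEquiv_tmul_mul, LinearEquiv.symm_apply_apply, LinearEquiv.symm_apply_apply]
      simp only [c, e, LinearMap.comp_apply, LinearEquiv.coe_coe, Finsupp.lapply_apply,
        TensorProduct.equivFinsuppOfBasisLeft_apply_tmul_apply, op_smul_eq_mul, smul_mul_assoc]
  refine .of_fintype
    (fun i => rightLinearMap (c i ∘ₗ (freeEquiv k A M).symm.toLinearMap) (hc i))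
    (fun i => rightLinearMap ((freeEquiv k A M).toLinearMap ∘ₗ TensorProduct.mk k M A (b i))
      fun a h => freeEquiv_tmul_mul (b i) h a)
    (LinearMap.ext fun x => ?_)
  obtain ⟨x, rfl⟩ := (freeEquiv k A M).surjective x
  have hsum : ∑ i, b i ⊗ₜ[k] c i x = x := by
    have h := e.symm_apply_apply x
    rwa [TensorProduct.equivFinsuppOfBasisLeft_symm_apply,
      Finsupp.sum_fintype _ _ fun i => TensorProduct.tmul_zero A (b i)] at h
  calc _ = freeEquiv k A M (∑ i, b i ⊗ₜ[k] c i x) := by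
        rw [map_sum, LinearMap.sum_apply]
        refine Finset.sum_congr rfl fun i _ => ?_
        exact congrArg (fun y => freeEquiv k A M (b i ⊗ₜ[k] c i y))
          ((freeEquiv k A M).symm_apply_apply x)
    _ = freeEquiv k A M x := by rw [hsum]

variable (A) in
/-- The right regular module `A`, as the left regular module of the opposite ring. -/
def regularEquivOp : A ≃ₗ[Aᵐᵒᵖ] Aᵐᵒᵖ where
  toAddEquiv := opAddEquiv
  map_smul' _ _ := rfl

theorem projective {N : Type u} [Module.Finite k M] [AddCommGroup N] [Module k N]
    [Module Aᵐᵒᵖ N] [IsScalarTower k Aᵐᵒᵖ N] [Module.Finite Aᵐᵒᵖ N] [Module.Projective Aᵐᵒᵖ N] :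
    Module.Projective Aᵐᵒᵖ (RightTensor k M N) := by
  have hN : SummandOfMultiple Aᵐᵒᵖ N A :=
    (summandOfMultiple_self_iff.mpr ⟨‹_›, ‹_›⟩).trans (.of_equiv (regularEquivOp A).symm)
  have hMN : SummandOfMultiple Aᵐᵒᵖ (RightTensor k M N) Aᵐᵒᵖ :=
    ((summandOfMultiple_of_right k M hN).trans (summandOfMultiple_self k A M)).trans
      (.of_equiv (regularEquivOp A))
  exact (summandOfMultiple_self_iff.mp hMN).2

end Free

end RightTensor

/-! ### Bimodules with a diagonal right action -/

/-- A bundled right `A`-module with its underlying `k`-module structure. Bundling lets the tensor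
powers of a module be defined by recursion, together with their actions. -/
structure KRightMod (k : Type v) (A : Type u) [Field k] [Ring A] [Algebra k A] where
  carrier : Type u
  [addCommGroup : AddCommGroup carrier]
  [moduleBase : Module k carrier]
  [moduleRight : Module Aᵐᵒᵖ carrier]
  [tower : IsScalarTower k Aᵐᵒᵖ carrier]

namespace KRightMod

attribute [instance] addCommGroup moduleBase moduleRight tower

/-- Restriction of a right module along an algebra homomorphism. -/
def restrict {k : Type v} [Field k] {A B : Type u} [Ring A] [Algebra k A] [Ring B] [Algebra k B]
    (f : B →ₐ[k] A) (M : KRightMod k A) : KRightMod k B :=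
  letI : Module Bᵐᵒᵖ M.carrier := Module.compHom M.carrier (AlgHom.op f).toRingHom
  { carrier := M.carrier
    tower := ⟨fun t b m =>
      (congrArg (· • m) ((AlgHom.op f).map_smul_of_tower t b)).trans (smul_assoc _ _ _)⟩ }

/-- The underlying vector space of a restricted module. -/
def restrictEquiv {k : Type v} [Field k] {A B : Type u} [Ring A] [Algebra k A] [Ring B]
    [Algebra k B] (f : B →ₐ[k] A) (M : KRightMod k A) : (M.restrict f).carrier ≃ₗ[k] M.carrier :=
  LinearEquiv.refl k M.carrier

/-- A homomorphism of modules, as a homomorphism of the restricted modules. -/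
def restrictHom {k : Type v} [Field k] {A B : Type u} [Ring A] [Algebra k A] [Ring B]
    [Algebra k B] (f : B →ₐ[k] A) {M N : KRightMod k A} (φ : M.carrier →ₗ[Aᵐᵒᵖ] N.carrier) :
    (M.restrict f).carrier →ₗ[Bᵐᵒᵖ] (N.restrict f).carrier :=
  rightLinearMap (k := k) (M := (M.restrict f).carrier) (N := (N.restrict f).carrier)
    (φ.restrictScalars k) fun b => φ.map_smul (op (f b))

theorem summandOfMultiple_restrict {k : Type v} [Field k] {A B : Type u} [Ring A] [Algebra k A]
    [Ring B] [Algebra k B] (f : B →ₐ[k] A) {M N : KRightMod k A}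
    (h : SummandOfMultiple Aᵐᵒᵖ M.carrier N.carrier) :
    SummandOfMultiple Bᵐᵒᵖ (M.restrict f).carrier (N.restrict f).carrier := by
  obtain ⟨q, φ, ψ, hφψ⟩ := h
  refine ⟨q, fun i => restrictHom f (φ i), fun i => restrictHom f (ψ i), LinearMap.ext fun x => ?_⟩
  rw [LinearMap.sum_apply]
  exact (LinearMap.sum_apply _ (fun i => ψ i ∘ₗ φ i) x).symm.trans (LinearMap.congr_fun hφψ x)

variable {k : Type v} [Field k] {A B : Type u} [Ring A] [Bialgebra k A] [Ring B] [Bialgebra k B]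

/-- The tensor product of two right modules over a bialgebra, with the diagonal action. -/
abbrev tensor (M N : KRightMod k A) : KRightMod k A where
  carrier := RightTensor k M.carrier N.carrier

/-- Restriction along a homomorphism of bialgebras commutes with tensor products. -/
def tensorRestrictEquiv (f : B →ₐc[k] A) (M N : KRightMod k A) :
    ((M.restrict (f : B →ₐ[k] A)).tensor (N.restrict (f : B →ₐ[k] A))).carrier ≃ₗ[Bᵐᵒᵖ]
      ((M.tensor N).restrict (f : B →ₐ[k] A)).carrier where
  toFun x := x
  invFun x := x
  map_add' _ _ := rfl
  map_smul' b x := by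
    have hid : RightTensor.map (restrictEquiv (f : B →ₐ[k] A) M).toLinearMap
        (restrictEquiv (f : B →ₐ[k] A) N).toLinearMap = LinearMap.id :=
      RightTensor.hom_ext fun _ _ => rfl
    have h := RightTensor.map_op_smul (.id k B) f.toCoalgHom
      (φ := (restrictEquiv (f : B →ₐ[k] A) M).toLinearMap)
      (ψ := (restrictEquiv (f : B →ₐ[k] A) N).toLinearMap)
      (fun _ _ => rfl) (fun _ _ => rfl) b.unop x
    rw [hid] at h
    exact h

end KRightMod

namespace KBimod

section General

variable {k : Type v} [Field k] {A B C D : Type u} [Ring A] [Algebra k A] [Ring B] [Algebra k B]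
  [Ring C] [Algebra k C] [Ring D] [Algebra k D]

/-- A `k`-linear map commuting with both actions, as a homomorphism of bimodules. -/
def homOfCommute {M N : KBimod k A B} (φ : M.carrier →ₗ[k] N.carrier)
    (hl : ∀ (a : A) m, φ (a • m) = a • φ m) (hr : ∀ (b : B) m, φ (op b • m) = op b • φ m) :
    M.carrier →ₗ[A ⊗[k] Bᵐᵒᵖ] N.carrier where
  toFun := φ
  map_add' := φ.map_add
  map_smul' z m := by
    induction z with
    | zero =>
      exact (congrArg φ (zero_smul (A ⊗[k] Bᵐᵒᵖ) m)).trans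
        ((map_zero φ).trans (zero_smul (A ⊗[k] Bᵐᵒᵖ) (φ m)).symm)
    | add z w hz hw => simp only [add_smul, map_add, hz, hw]
    | tmul a b => exact (hl a (b • m)).trans (congrArg (a • ·) (hr b.unop m))

/-- An isomorphism of bimodules. -/
structure Iso (M N : KBimod k A B) where
  toEquiv : M.carrier ≃ₗ[k] N.carrier
  map_left : ∀ (a : A) m, toEquiv (a • m) = a • toEquiv m
  map_right : ∀ (b : B) m, toEquiv (op b • m) = op b • toEquiv m

namespace Iso

/-- The composition of two isomorphisms. -/
def trans {M N P : KBimod k A B} (e : Iso M N) (e' : Iso N P) : Iso M P where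
  toEquiv := e.toEquiv.trans e'.toEquiv
  map_left a m := by simp only [LinearEquiv.trans_apply, e.map_left, e'.map_left]
  map_right b m := by simp only [LinearEquiv.trans_apply, e.map_right, e'.map_right]

/-- The inverse of an isomorphism. -/
def symm {M N : KBimod k A B} (e : Iso M N) : Iso N M where
  toEquiv := e.toEquiv.symm
  map_left a m := by rw [LinearEquiv.symm_apply_eq, e.map_left, LinearEquiv.apply_symm_apply]
  map_right b m := by rw [LinearEquiv.symm_apply_eq, e.map_right, LinearEquiv.apply_symm_apply]

/-- Restriction of an isomorphism. -/
def restrict (f : C →ₐ[k] A) (g : D →ₐ[k] B) {M N : KBimod k A B} (e : Iso M N) :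
    Iso (M.restrict f g) (N.restrict f g) where
  toEquiv := e.toEquiv
  map_left c := e.map_left (f c)
  map_right d := e.map_right (g d)

theorem summandOfMultiple {M N : KBimod k A B} (e : Iso M N) :
    SummandOfMultiple (A ⊗[k] Bᵐᵒᵖ) M.carrier N.carrier :=
  .of_retract (homOfCommute e.toEquiv.toLinearMap e.map_left e.map_right)
    (homOfCommute e.symm.toEquiv.toLinearMap e.symm.map_left e.symm.map_right)
    (LinearMap.ext e.toEquiv.symm_apply_apply)

end Iso

end General

section Diag

variable {k : Type v} [Field k] {A B : Type u} [Ring A] [Algebra k A] [Ring B] [Bialgebra k B]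

/-- The bimodule `M ⊗ N` over `k`, for an `A`-`B`-bimodule `M` and a right `B`-module `N`, with
`A` acting on `M` and `B` acting diagonally. -/
def diag (M : KBimod k A B) (N : KRightMod k B) : KBimod k A B where
  carrier := RightTensor k M.carrier N.carrier
  moduleLeft := inferInstanceAs (Module A (M.carrier ⊗[k] N.carrier))
  towerLeft := inferInstanceAs (IsScalarTower k A (M.carrier ⊗[k] N.carrier))
  comm := by
    let _ : Module A (RightTensor k M.carrier N.carrier) :=
      inferInstanceAs (Module A (M.carrier ⊗[k] N.carrier))
    have : IsScalarTower k A (RightTensor k M.carrier N.carrier) :=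
      inferInstanceAs (IsScalarTower k A (M.carrier ⊗[k] N.carrier))
    have hmap (a : A) : Algebra.lsmul k k (RightTensor k M.carrier N.carrier) a =
        RightTensor.map (Algebra.lsmul k k M.carrier a) LinearMap.id :=
      RightTensor.hom_ext fun _ _ => rfl
    refine ⟨fun a b x => ?_⟩
    have h := RightTensor.map_op_smul (.id k B) (.id k B)
      (φ := Algebra.lsmul k k M.carrier a) (ψ := LinearMap.id (M := N.carrier))
      (fun b m => smul_comm a (op b) m) (fun _ _ => rfl) b.unop x
    rw [← hmap] at h
    exact h

/-- The underlying vector space of `M ⊗ N`. -/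
def diagOf (M : KBimod k A B) (N : KRightMod k B) :
    M.carrier ⊗[k] N.carrier ≃ₗ[k] (M.diag N).carrier :=
  RightTensor.of k M.carrier N.carrier

theorem map_smul_of_map_tmul {M : KBimod k A B} {N : KRightMod k B} {C : Type u} [Ring C]
    [Algebra k C] {X : KBimod k A C} {Φ : (M.diag N).carrier →ₗ[k] X.carrier}
    (h : ∀ (a : A) m n, Φ (diagOf M N ((a • m) ⊗ₜ n)) = a • Φ (diagOf M N (m ⊗ₜ n))) (a : A)
    (x : (M.diag N).carrier) : Φ (a • x) = a • Φ x := by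
  have hcomp : Φ ∘ₗ Algebra.lsmul k k (M.diag N).carrier a =
      Algebra.lsmul k k X.carrier a ∘ₗ Φ :=
    RightTensor.hom_ext (h a)
  exact LinearMap.congr_fun hcomp x

/-- An isomorphism `M ≅ M'` induces an isomorphism `M ⊗ N ≅ M' ⊗ N`. -/
def Iso.diag {M M' : KBimod k A B} (e : Iso M M') (N : KRightMod k B) :
    Iso (M.diag N) (M'.diag N) where
  toEquiv := (diagOf M N).symm ≪≫ₗ TensorProduct.congr e.toEquiv (LinearEquiv.refl k N.carrier)
    ≪≫ₗ diagOf M' N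
  map_left := map_smul_of_map_tmul fun a m n =>
    congrArg (fun m => diagOf M' N (m ⊗ₜ n)) (e.map_left a m)
  map_right := RightTensor.map_op_smul (.id k B) (.id k B) e.map_right fun _ _ => rfl

/-- The associativity isomorphism `(M ⊗ N) ⊗ P ≅ M ⊗ (N ⊗ P)`. -/
def diagAssoc (M : KBimod k A B) (N P : KRightMod k B) :
    Iso ((M.diag N).diag P) (M.diag (N.tensor P)) where
  toEquiv := RightTensor.assoc k M.carrier N.carrier P.carrier
  map_left := map_smul_of_map_tmul (X := M.diag (N.tensor P)) fun a y p => map_smul_of_map_tmul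
    (X := M.diag (N.tensor P))
    (Φ := (RightTensor.assoc k M.carrier N.carrier P.carrier).toLinearMap ∘ₗ
      (diagOf (M.diag N) P).toLinearMap ∘ₗ (TensorProduct.mk k _ _).flip p)
    (fun _ _ _ => rfl) a y
  map_right := RightTensor.assoc_op_smul

/-- The map `id ⊗ φ : M ⊗ N → M ⊗ N'`. -/
def diagMap (M : KBimod k A B) {N N' : KRightMod k B} (φ : N.carrier →ₗ[k] N'.carrier) :
    (M.diag N).carrier →ₗ[k] (M.diag N').carrier :=
  RightTensor.map (LinearMap.id (M := M.carrier)) φ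

variable {C : Type u} [Ring C] [Bialgebra k C]

theorem diagMap_op_smul (f : C →ₐc[k] B) (M : KBimod k A B) {N N' : KRightMod k B}
    {φ : N.carrier →ₗ[k] N'.carrier} (hφ : ∀ c n, φ (op (f c) • n) = op (f c) • φ n) (c : C)
    (x : (M.diag N).carrier) : M.diagMap φ (op (f c) • x) = op (f c) • M.diagMap φ x :=
  RightTensor.map_op_smul f.toCoalgHom f.toCoalgHom (fun _ _ => rfl) hφ c x

theorem summandOfMultiple_diag_restrict (f : C →ₐc[k] B) (M : KBimod k A B) {N N' : KRightMod k B}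
    (h : SummandOfMultiple Cᵐᵒᵖ (N.restrict (f : C →ₐ[k] B)).carrier
      (N'.restrict (f : C →ₐ[k] B)).carrier) :
    SummandOfMultiple (A ⊗[k] Cᵐᵒᵖ)
      ((M.diag N).restrict (AlgHom.id k A) (f : C →ₐ[k] B)).carrier
      ((M.diag N').restrict (AlgHom.id k A) (f : C →ₐ[k] B)).carrier := by
  let diagHom {X Y : KRightMod k B} (φ : (X.restrict (f : C →ₐ[k] B)).carrier →ₗ[Cᵐᵒᵖ]
      (Y.restrict (f : C →ₐ[k] B)).carrier) :
      ((M.diag X).restrict (AlgHom.id k A) (f : C →ₐ[k] B)).carrier →ₗ[A ⊗[k] Cᵐᵒᵖ]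
        ((M.diag Y).restrict (AlgHom.id k A) (f : C →ₐ[k] B)).carrier :=
    homOfCommute (M.diagMap (N := X) (N' := Y) (φ.restrictScalars k))
      (map_smul_of_map_tmul (X := M.diag Y) fun _ _ _ => rfl)
      (diagMap_op_smul f M fun c n => φ.map_smul (op c) n)
  obtain ⟨q, φ, ψ, hφψ⟩ := h
  refine ⟨q, fun i => diagHom (φ i), fun i => diagHom (ψ i), LinearMap.ext fun x => ?_⟩
  rw [LinearMap.sum_apply]
  induction x using RightTensor.induction_on with
  | add x y hx hy =>
    refine (Finset.sum_congr rfl fun i _ => map_add _ x y).trans ?_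
    exact Finset.sum_add_distrib.trans (congrArg₂ (· + ·) hx hy)
  | tmul m n =>
    have hn : ∑ i, ψ i (φ i n) = n :=
      (LinearMap.sum_apply _ _ _).symm.trans (LinearMap.congr_fun hφψ n)
    refine (map_sum (M.diagOf N) (fun i => m ⊗ₜ[k] ψ i (φ i n)) Finset.univ).symm.trans ?_
    exact congrArg (M.diagOf N) ((TensorProduct.tmul_sum _ _ _).symm.trans (congrArg _ hn))

end Diag

end KBimod

/-! ### The permutation module of a Hopf subalgebra -/

namespace HopfSubalgebra

variable {k : Type v} {H : Type u} [Field k] [Ring H] [HopfAlgebra k H] (R : HopfSubalgebra k H)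

/-- The inclusion of a Hopf subalgebra, as a homomorphism of bialgebras. -/
def inclHom : R.Carrier →ₐc[k] H :=
  .ofAlgHom R.toSubalgebra.val rfl (AlgHom.ext R.inclTensor_comul)

instance : Module k R.PermModule := inferInstanceAs (Module k (H ⧸ R.augIdeal))

instance : IsScalarTower k Hᵐᵒᵖ R.PermModule :=
  inferInstanceAs (IsScalarTower k Hᵐᵒᵖ (H ⧸ R.augIdeal))

/-- The permutation module `V = H / R⁺ H` as a bundled right `H`-module. -/
def permMod : KRightMod k H where
  carrier := R.PermModule

/-- The quotient map `H → V`. -/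
def permMk : H →ₗ[Hᵐᵒᵖ] R.permMod.carrier := R.augIdeal.mkQ

theorem permMk_surjective : Function.Surjective R.permMk := R.augIdeal.mkQ_surjective

theorem permMk_mul (r : R.Carrier) (h : H) :
    R.permMk (r * h) = counit (R := k) r • R.permMk h := by
  have hr : (r : H) - algebraMap k H (counit r) ∈ R.augIdeal := by
    refine Submodule.subset_span ⟨R.toSubalgebra.sub_mem r.2 (R.toSubalgebra.algebraMap_mem _), ?_⟩
    rw [map_sub, Bialgebra.counit_algebraMap, coe_counit, sub_self]
  have hrh := R.augIdeal.smul_mem (op h) hr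
  rw [op_smul_eq_mul, sub_mul, ← Algebra.smul_def] at hrh
  exact (Submodule.Quotient.eq R.augIdeal).mpr hrh

theorem eq_zero_of_mem_augIdeal {X : Type*} [AddCommGroup X] [Module k X] (f : H →ₗ[k] X)
    (hf : ∀ (r : R.Carrier) h, f (r * h) = counit (R := k) r • f h) {x : H}
    (hx : x ∈ R.augIdeal) : f x = 0 := by
  suffices h : ∀ y, f (x * y) = 0 by simpa only [mul_one] using h 1
  induction hx using Submodule.span_induction with
  | mem x hx => exact fun y => by rw [hf ⟨x, hx.1⟩ y, coe_counit, hx.2, zero_smul]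
  | zero => exact fun y => by rw [zero_mul, map_zero]
  | add x x' _ _ h h' => exact fun y => by rw [add_mul, map_add, h, h', add_zero]
  | smul a x _ h => exact fun y => by rw [← op_unop a, op_smul_eq_mul, mul_assoc, h]

/-- The linear map on `V` induced by an `R⁺`-invariant linear map on `H`. -/
def permLift {X : Type*} [AddCommGroup X] [Module k X] (f : H →ₗ[k] X)
    (hf : ∀ (r : R.Carrier) h, f (r * h) = counit (R := k) r • f h) :
    R.permMod.carrier →ₗ[k] X :=
  (R.augIdeal.restrictScalars k).liftQ f fun _ hx => R.eq_zero_of_mem_augIdeal f hf hx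

/-- The map `V → k` induced by the counit. -/
def permCounit : R.permMod.carrier →ₗ[k] k :=
  R.permLift counit fun r h => by rw [Bialgebra.counit_mul, coe_counit, smul_eq_mul]

theorem permCounit_op_smul (a : H) (v : R.permMod.carrier) :
    R.permCounit (op a • v) = counit (R := k) a * R.permCounit v := by
  obtain ⟨h, rfl⟩ := R.permMk_surjective v
  exact (Bialgebra.counit_mul h a).trans (mul_comm _ _)

/-- The class of `1` in `V`. -/
def permOne : R.permMod.carrier := R.permMk 1

theorem permCounit_permOne : R.permCounit R.permOne = 1 := Bialgebra.counit_one

theorem op_smul_permOne (r : R.Carrier) :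
    op (r : H) • R.permOne = counit (R := k) r • R.permOne := by
  rw [permOne, ← map_smul, ← permMk_mul, op_smul_eq_mul, one_mul, mul_one]

theorem op_smul_tmul_permOne {M : Type u} [AddCommGroup M] [Module k M] [Module Hᵐᵒᵖ M]
    [IsScalarTower k Hᵐᵒᵖ M] (r : R.Carrier) (m : M) :
    op (r : H) • RightTensor.of k M R.permMod.carrier (m ⊗ₜ R.permOne) =
      RightTensor.of k M R.permMod.carrier ((op (r : H) • m) ⊗ₜ R.permOne) :=
  RightTensor.op_smul_of_tmul_of_invariant R.inclHom.toCoalgHom R.op_smul_permOne r m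

instance [FiniteDimensional k H] : Module.Finite k R.permMod.carrier :=
  Module.Finite.of_surjective (R.permMk.restrictScalars k) R.permMk_surjective

section Induced

variable {A : Type u} [Ring A] [Algebra k A] (M : KBimod k A H)

/-- The bimodule `M ⊗_R H`. -/
abbrev induced : KBimod k A H :=
  (M.restrict (AlgHom.id k A) R.toSubalgebra.val).tensor
    ((KBimod.regular k H).restrict R.toSubalgebra.val (AlgHom.id k H))

/-- The quotient map `M ⊗ H → M ⊗_R H`. -/
def inducedMk : M.carrier ⊗[k] H →ₗ[k] (R.induced M).carrier :=
  Submodule.mkQ (M := M.carrier ⊗[k] H)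
    (KBimod.balancingRelations (M.restrict (AlgHom.id k A) R.toSubalgebra.val)
      ((KBimod.regular k H).restrict R.toSubalgebra.val (AlgHom.id k H)))

theorem inducedMk_surjective : Function.Surjective (R.inducedMk M) :=
  Submodule.Quotient.mk_surjective _

theorem inducedMk_op_smul_tmul (m : M.carrier) (r : R.Carrier) (h : H) :
    R.inducedMk M ((op (r : H) • m) ⊗ₜ h) = R.inducedMk M (m ⊗ₜ (r * h)) :=
  (Submodule.Quotient.eq
    (KBimod.balancingRelations (M.restrict (AlgHom.id k A) R.toSubalgebra.val)
      ((KBimod.regular k H).restrict R.toSubalgebra.val (AlgHom.id k H)))).mpr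
    (Submodule.subset_span ⟨m, r, h, rfl⟩)

/-- The linear map on `M ⊗_R H` induced by a balanced linear map on `M ⊗ H`. -/
def inducedLift {X : Type*} [AddCommGroup X] [Module k X] (f : M.carrier ⊗[k] H →ₗ[k] X)
    (hf : ∀ m (r : R.Carrier) h, f ((op (r : H) • m) ⊗ₜ h) = f (m ⊗ₜ (r * h))) :
    (R.induced M).carrier →ₗ[k] X :=
  Submodule.liftQ _ f <| by
    refine Submodule.span_le.mpr ?_
    rintro _ ⟨m, r, h, rfl⟩
    exact (map_sub f _ _).trans (sub_eq_zero.mpr (hf m r h))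

/-- The quotient map `M ⊗ H → M ⊗_R H`, transported to the diagonal action on `M ⊗ H`. -/
def inducedOfDiag : RightTensor k M.carrier H →ₗ[Hᵐᵒᵖ] (R.induced M).carrier :=
  rightLinearMap (R.inducedMk M ∘ₗ (RightTensor.freeEquiv k H M.carrier).symm.toLinearMap)
    fun a x => by
      obtain ⟨x, rfl⟩ := (RightTensor.freeEquiv k H M.carrier).surjective x
      induction x with
      | zero => simp only [map_zero, smul_zero]
      | add x y hx hy => simp only [map_add, smul_add, hx, hy]
      | tmul m h =>
        simp only [LinearMap.comp_apply, LinearEquiv.coe_coe]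
        rw [← RightTensor.freeEquiv_tmul_mul]
        simp only [LinearEquiv.symm_apply_apply]
        rfl

theorem inducedOfDiag_freeEquiv (x : M.carrier ⊗[k] H) :
    R.inducedOfDiag M (RightTensor.freeEquiv k H M.carrier x) = R.inducedMk M x :=
  congrArg (R.inducedMk M) ((RightTensor.freeEquiv k H M.carrier).symm_apply_apply x)

theorem inducedOfDiag_surjective : Function.Surjective (R.inducedOfDiag M) := fun x => by
  obtain ⟨x, rfl⟩ := R.inducedMk_surjective M x
  exact ⟨_, R.inducedOfDiag_freeEquiv M x⟩

/-- The quotient map `M ⊗ H → M ⊗ V`. -/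
def diagPermMk : RightTensor k M.carrier H →ₗ[Hᵐᵒᵖ] (M.diag R.permMod).carrier :=
  RightTensor.mapHom LinearMap.id R.permMk

theorem diagPermMk_surjective : Function.Surjective (R.diagPermMk M) :=
  TensorProduct.map_surjective Function.surjective_id R.permMk_surjective

theorem diagPermMk_freeEquiv_tmul (m : M.carrier) (h : H) :
    R.diagPermMk M (RightTensor.freeEquiv k H M.carrier (m ⊗ₜ h)) =
      op h • M.diagOf R.permMod (m ⊗ₜ R.permOne) := by
  rw [RightTensor.freeEquiv_tmul, map_smul]
  rfl

/-- The map `M ⊗_R H → M ⊗ V`, `m ⊗ h ↦ (m ⊗ 1̄) h`. -/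
def inducedToDiag : (R.induced M).carrier →ₗ[k] (M.diag R.permMod).carrier :=
  R.inducedLift M ((R.diagPermMk M).restrictScalars k ∘ₗ
    (RightTensor.freeEquiv k H M.carrier).toLinearMap) fun m r h => by
      have hm : M.diagOf R.permMod ((op (r : H) • m) ⊗ₜ R.permOne) =
          op (r : H) • M.diagOf R.permMod (m ⊗ₜ R.permOne) := (R.op_smul_tmul_permOne r m).symm
      refine (R.diagPermMk_freeEquiv_tmul M _ h).trans ?_
      refine Eq.trans ?_ (R.diagPermMk_freeEquiv_tmul M m (r * h)).symm
      rw [hm, op_mul, mul_smul]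

theorem inducedToDiag_inducedOfDiag (x : RightTensor k M.carrier H) :
    R.inducedToDiag M (R.inducedOfDiag M x) = R.diagPermMk M x :=
  congrArg (R.diagPermMk M) ((RightTensor.freeEquiv k H M.carrier).apply_symm_apply x)

theorem inducedOfDiag_tmul_coe (m : M.carrier) (r : R.Carrier) :
    R.inducedOfDiag M (RightTensor.of k M.carrier H (m ⊗ₜ (r : H))) =
      counit (R := k) r • R.inducedMk M (m ⊗ₜ 1) := by
  let incl := R.toSubalgebra.val.toLinearMap
  have hbalanced : R.inducedMk M ∘ₗ
        TensorProduct.map (orbitMap k H m ∘ₗ HopfAlgebra.antipode k) LinearMap.id ∘ₗ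
          TensorProduct.map incl incl =
      R.inducedMk M ∘ₗ (TensorProduct.mk k M.carrier H).flip 1 ∘ₗ orbitMap k H m ∘ₗ incl ∘ₗ
        LinearMap.mul' k R.Carrier ∘ₗ (HopfAlgebra.antipode k).rTensor R.Carrier :=
    TensorProduct.ext' fun p q => by
      have h := R.inducedMk_op_smul_tmul M (op (HopfAlgebra.antipode k (p : H)) • m) q 1
      rw [mul_one, ← mul_smul, ← op_mul] at h
      exact h.symm
  calc _ = R.inducedMk M (TensorProduct.map (orbitMap k H m ∘ₗ HopfAlgebra.antipode k)
        LinearMap.id (R.inclTensor (comul r))) := by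
        rw [R.inclTensor_comul, ← RightTensor.freeEquiv_symm_of_tmul]
        rfl
    _ = R.inducedMk M (orbitMap k H m (incl (LinearMap.mul' k R.Carrier
          ((HopfAlgebra.antipode k).rTensor R.Carrier (comul r)))) ⊗ₜ 1) :=
        LinearMap.congr_fun hbalanced (comul r)
    _ = _ := by
        rw [HopfAlgebra.mul_antipode_rTensor_comul_apply, Algebra.algebraMap_eq_smul_one,
          map_smul, map_smul, ← TensorProduct.smul_tmul', map_smul]
        exact congrArg (fun m => _ • R.inducedMk M (m ⊗ₜ 1)) (one_smul Hᵐᵒᵖ m)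

theorem inducedOfDiag_tmul_mul (m : M.carrier) (r : R.Carrier) (h : H) :
    R.inducedOfDiag M (RightTensor.of k M.carrier H (m ⊗ₜ (r * h))) =
      counit (R := k) r • R.inducedOfDiag M (RightTensor.of k M.carrier H (m ⊗ₜ h)) := by
  have hlinear : R.inducedOfDiag M ∘ₗ RightTensor.mapHom LinearMap.id
        (DistribSMul.toLinearMap Hᵐᵒᵖ H (r : H)) =
      counit (R := k) r • R.inducedOfDiag M := by
    refine RightTensor.hom_ext_of_tmul_one fun m => ?_
    have hone : R.inducedOfDiag M (RightTensor.of k M.carrier H (m ⊗ₜ 1)) =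
        R.inducedMk M (m ⊗ₜ 1) := by
      simpa only [Bialgebra.counit_one, one_smul, OneMemClass.coe_one] using
        R.inducedOfDiag_tmul_coe M m 1
    rw [LinearMap.comp_apply, RightTensor.mapHom_of_tmul, LinearMap.smul_apply, hone,
      ← inducedOfDiag_tmul_coe]
    exact congrArg (fun h => R.inducedOfDiag M (RightTensor.of k M.carrier H (m ⊗ₜ h)))
      (mul_one (r : H))
  exact LinearMap.congr_fun hlinear (RightTensor.of k M.carrier H (m ⊗ₜ h))

/-- The map `M ⊗ V → M ⊗_R H` induced by `inducedOfDiag`, which is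
`m ⊗ h̄ ↦ m S(h₍₁₎) ⊗ h₍₂₎`. -/
def diagToInduced : (M.diag R.permMod).carrier →ₗ[k] (R.induced M).carrier :=
  TensorProduct.lift (R.permLift (TensorProduct.curry ((R.inducedOfDiag M).restrictScalars k ∘ₗ
    (RightTensor.of k M.carrier H).toLinearMap)).flip fun r h =>
      LinearMap.ext fun m => R.inducedOfDiag_tmul_mul M m r h).flip

theorem diagToInduced_diagPermMk (x : RightTensor k M.carrier H) :
    R.diagToInduced M (R.diagPermMk M x) = R.inducedOfDiag M x := by
  induction x using RightTensor.induction_on with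
  | tmul m h => rfl
  | add x y hx hy => simp only [map_add, hx, hy]

/-- The isomorphism `M ⊗_R H ≅ M ⊗ V`, `m ⊗ h ↦ (m ⊗ 1̄) h`. -/
def inducedIso : KBimod.Iso (R.induced M) (M.diag R.permMod) where
  toEquiv := LinearEquiv.ofLinearMap (R.inducedToDiag M) (R.diagToInduced M)
    (LinearMap.ext fun x => by
      obtain ⟨x, rfl⟩ := R.diagPermMk_surjective M x
      rw [LinearMap.comp_apply, diagToInduced_diagPermMk, inducedToDiag_inducedOfDiag]
      rfl)
    (LinearMap.ext fun x => by
      obtain ⟨x, rfl⟩ := R.inducedOfDiag_surjective M x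
      rw [LinearMap.comp_apply, inducedToDiag_inducedOfDiag, diagToInduced_diagPermMk]
      rfl)
  map_left a x := by
    obtain ⟨x, rfl⟩ := R.inducedMk_surjective M x
    induction x with
    | zero => simp only [map_zero, smul_zero]
    | add x y hx hy => simp only [map_add, smul_add, hx, hy]
    | tmul m h =>
      have hF (m : M.carrier) : R.inducedToDiag M (R.inducedMk M (m ⊗ₜ h)) = op h •
          M.diagOf R.permMod (m ⊗ₜ R.permOne) := R.diagPermMk_freeEquiv_tmul M m h
      refine (hF (a • m)).trans (Eq.trans ?_ (congrArg (a • ·) (hF m).symm))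
      exact (smul_comm a (op h) (M.diagOf R.permMod (m ⊗ₜ R.permOne))).symm
  map_right b x := by
    obtain ⟨x, rfl⟩ := R.inducedOfDiag_surjective M x
    have hF := R.inducedToDiag_inducedOfDiag M
    change R.inducedToDiag M (op b • R.inducedOfDiag M x) =
      op b • R.inducedToDiag M (R.inducedOfDiag M x)
    rw [← map_smul, hF, hF, map_smul]

end Induced

section TensorPowers

/-- The tensor power `V ⊗ ⋯ ⊗ V` with `n + 1` factors. -/
def permPow : ℕ → KRightMod k H
  | 0 => R.permMod
  | n + 1 => (permPow n).tensor R.permMod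

/-- The tensor power `V ⊗ ⋯ ⊗ V` with `n + 1` factors, as a right `R`-module. -/
abbrev permPowRes (n : ℕ) : KRightMod k R.Carrier :=
  (R.permPow n).restrict (R.inclHom : R.Carrier →ₐ[k] H)

/-- The isomorphism `H ⊗_R ⋯ ⊗_R H ≅ H ⊗ V ⊗ ⋯ ⊗ V`, with `n + 2` factors on the left and `n + 1`
factors `V` on the right. -/
def tensorPowIso : (n : ℕ) → KBimod.Iso (tensorPow R.toSubalgebra (n + 1))
    ((KBimod.regular k H).diag (R.permPow n))
  | 0 => R.inducedIso (KBimod.regular k H)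
  | n + 1 => (R.inducedIso (tensorPow R.toSubalgebra (n + 1))).trans <|
      ((tensorPowIso n).diag R.permMod).trans (KBimod.diagAssoc _ (R.permPow n) R.permMod)

/-- The projection `V ⊗ ⋯ ⊗ V ⊗ V → V ⊗ ⋯ ⊗ V` given by the counit on the last factor. -/
def permPowProj (n : ℕ) : (R.permPow (n + 1)).carrier →ₗ[Hᵐᵒᵖ] (R.permPow n).carrier :=
  RightTensor.proj R.permCounit R.permCounit_op_smul

theorem permPowProj_of_tmul_permOne (n : ℕ) (m : (R.permPow n).carrier) :
    R.permPowProj n (RightTensor.of k _ R.permMod.carrier (m ⊗ₜ R.permOne)) = m := by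
  refine (RightTensor.proj_of_tmul R.permCounit R.permCounit_op_smul m R.permOne).trans ?_
  rw [permCounit_permOne, one_smul]

theorem permPowProj_surjective (n : ℕ) : Function.Surjective (R.permPowProj n) := fun m =>
  ⟨_, R.permPowProj_of_tmul_permOne n m⟩

theorem summandOfMultiple_permPowRes_succ (n : ℕ) :
    SummandOfMultiple R.Carrierᵐᵒᵖ (R.permPowRes n).carrier (R.permPowRes (n + 1)).carrier :=
  .of_retract
    (rightLinearMap (k := k) (M := (R.permPowRes n).carrier) (N := (R.permPowRes (n + 1)).carrier)
      ((RightTensor.of k _ R.permMod.carrier).toLinearMap ∘ₗ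
        (TensorProduct.mk k (R.permPow n).carrier R.permMod.carrier).flip R.permOne)
      fun r m => (R.op_smul_tmul_permOne (M := (R.permPow n).carrier) r m).symm)
    (KRightMod.restrictHom _ (R.permPowProj n))
    (LinearMap.ext (R.permPowProj_of_tmul_permOne n))

theorem minDepth_lt_top_of_summandOfMultiple {n : ℕ}
    (h : SummandOfMultiple R.Carrierᵐᵒᵖ (R.permPowRes (n + 1)).carrier (R.permPowRes n).carrier) :
    minDepth R.toSubalgebra < ⊤ := by
  have summandOfMultiple_tensorPow {i j : ℕ} (hij : SummandOfMultiple R.Carrierᵐᵒᵖ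
      (R.permPowRes i).carrier (R.permPowRes j).carrier) :
      SummandOfMultiple (H ⊗[k] R.Carrierᵐᵒᵖ)
        ((tensorPow R.toSubalgebra (i + 1)).restrict (AlgHom.id k H) R.toSubalgebra.val).carrier
        ((tensorPow R.toSubalgebra (j + 1)).restrict (AlgHom.id k H) R.toSubalgebra.val).carrier :=
    have iso (m : ℕ) := (R.tensorPowIso m).restrict (AlgHom.id k H) R.toSubalgebra.val
    (iso i).summandOfMultiple.trans
      ((KBimod.summandOfMultiple_diag_restrict R.inclHom (KBimod.regular k H) hij).trans
        (iso j).symm.summandOfMultiple)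
  have hdepth : HasRightDepth R.toSubalgebra (n + 1) :=
    similar_of_summandOfMultiple (summandOfMultiple_tensorPow h)
      (summandOfMultiple_tensorPow (R.summandOfMultiple_permPowRes_succ n))
  have hmem : ((2 * (n + 1 + 1) : ℕ) : ℕ∞) ∈ {d : ℕ∞ | ∃ m : ℕ, d = m ∧
      HasDepth R.toSubalgebra m} := ⟨_, rfl, Or.inr ⟨n + 1, rfl, Or.inr hdepth⟩⟩
  exact (sInf_le hmem).trans_lt (ENat.natCast_lt_top _)

end TensorPowers

end HopfSubalgebra

/-! ### Pointed duals -/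

section Pointed

theorem exists_isSimpleSubcoalgebra_le {k : Type v} [Field k] {C : Type u} [AddCommGroup C]
    [Module k C] [Coalgebra k C] [FiniteDimensional k C] {E : Submodule k C}
    (hE : IsSubcoalgebra E) (hne : E ≠ ⊥) : ∃ D ≤ E, IsSimpleSubcoalgebra D := by
  obtain ⟨D, ⟨hD, hD0, hDE⟩, hmin⟩ := WellFounded.has_min
    (wellFounded_lt (α := Submodule k C))
    {D | IsSubcoalgebra D ∧ D ≠ ⊥ ∧ D ≤ E} ⟨E, hE, hne, le_rfl⟩
  refine ⟨D, hDE, hD, hD0, fun F hF hFD => or_iff_not_imp_left.mpr fun hF0 => ?_⟩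
  exact eq_of_le_of_not_lt hFD (hmin F ⟨hF, hF0, hFD.trans hDE⟩)

theorem exists_comul_eq_smul_tmul_self {k : Type v} [Field k] {C : Type u} [AddCommGroup C]
    [Module k C] [Coalgebra k C] {D : Submodule k C} (hD : IsSubcoalgebra D)
    (hrank : Module.finrank k D = 1) :
    ∃ x ∈ D, x ≠ 0 ∧ ∃ c : k, comul (R := k) x = c • (x ⊗ₜ x) := by
  obtain ⟨x, hx, hspan⟩ := finrank_eq_one_iff'.mp hrank
  refine ⟨x, x.2, fun h => hx (Subtype.ext h), ?_⟩
  have map_subtype (w : D ⊗[k] D) :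
      ∃ c : k, TensorProduct.map D.subtype D.subtype w = c • ((x : C) ⊗ₜ (x : C)) := by
    induction w with
    | zero => exact ⟨0, by rw [map_zero, zero_smul]⟩
    | add w z hw hz =>
      obtain ⟨c, hc⟩ := hw
      obtain ⟨d, hd⟩ := hz
      exact ⟨c + d, by rw [map_add, hc, hd, add_smul]⟩
    | tmul y z =>
      obtain ⟨s, rfl⟩ := hspan y
      obtain ⟨t, rfl⟩ := hspan z
      exact ⟨s * t, TensorProduct.smul_tmul_smul s t (x : C) (x : C)⟩
  obtain ⟨w, hw⟩ := hD x x.2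
  exact hw ▸ map_subtype w

section Dual

variable {k : Type v} [Field k] {A : Type u} [Ring A] [Algebra k A]

-- For `f` vanishing on `I`, the form `a ⊗ b ↦ f (a * b)` descends to `A ⧸ I ⊗ A ⧸ I`.
theorem isSubcoalgebra_dualAnnihilator [FiniteDimensional k A] (I : Submodule k A)
    (hl : ∀ a, ∀ b ∈ I, a * b ∈ I) (hr : ∀ a ∈ I, ∀ b, a * b ∈ I) :
    let := dualCoalgebra k A
    IsSubcoalgebra I.dualAnnihilator := by
  intro _ f hf
  have hfI : ∀ x ∈ I, f x = 0 := (Submodule.mem_dualAnnihilator f).mp hf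
  let left : (A ⧸ I) →ₗ[k] A →ₗ[k] k := I.liftQ ((LinearMap.mul k A).compr₂ f) fun a ha =>
    LinearMap.ext fun b => hfI _ (hr a ha b)
  let both : (A ⧸ I) →ₗ[k] (A ⧸ I) →ₗ[k] k := I.liftQ left.flip fun b hb =>
    I.linearMap_qext (LinearMap.ext fun a => hfI _ (hl a b hb))
  let g : Module.Dual k ((A ⧸ I) ⊗[k] (A ⧸ I)) := TensorProduct.lift both.flip
  let w := (TensorProduct.dualDistribEquiv k (A ⧸ I) (A ⧸ I)).symm g
  have hw : TensorProduct.dualDistrib k (A ⧸ I) (A ⧸ I) w = g :=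
    (TensorProduct.dualDistribEquiv k (A ⧸ I) (A ⧸ I)).apply_symm_apply g
  let pullback : Module.Dual k (A ⧸ I) →ₗ[k] I.dualAnnihilator :=
    I.dualQuotEquivDualAnnihilator.toLinearMap
  have hpullback (a b : A) : (LinearMap.applyₗ (a ⊗ₜ[k] b) ∘ₗ TensorProduct.dualDistrib k A A) ∘ₗ
        TensorProduct.map I.dualAnnihilator.subtype I.dualAnnihilator.subtype ∘ₗ
          TensorProduct.map pullback pullback =
      LinearMap.applyₗ (I.mkQ a ⊗ₜ[k] I.mkQ b) ∘ₗ TensorProduct.dualDistrib k (A ⧸ I) (A ⧸ I) :=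
    TensorProduct.ext' fun _ _ => rfl
  refine ⟨TensorProduct.map pullback pullback w, (TensorProduct.dualDistribEquiv k A A).injective
    (TensorProduct.ext' fun a b => ?_)⟩
  refine (LinearMap.congr_fun (hpullback a b) w).trans ?_
  refine Eq.trans ?_ (dualDistrib_dualComul f a b).symm
  exact LinearMap.congr_fun hw (I.mkQ a ⊗ₜ I.mkQ b)

theorem exists_ne_zero_of_traceSubmodule_eq_top {S M N : Type*} [Ring S] [AddCommGroup M]
    [Module S M] [AddCommGroup N] [Module S N] [Nontrivial M] (h : traceSubmodule S M N = ⊤) :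
    ∃ g : N →ₗ[S] M, g ≠ 0 := by
  by_contra! hzero
  refine bot_ne_top (α := Submodule S M) (Eq.trans (Eq.symm ?_) h)
  exact iSup_eq_bot.mpr fun g => by rw [hzero g, LinearMap.range_zero]

-- The kernel of `f` is a right ideal with one-dimensional quotient, killed by the annihilator of
-- `M`; so there is a non-zero, hence injective, homomorphism from `M` to this quotient.
theorem exists_injective_of_mul_eq [IsArtinianRing Aᵐᵒᵖ] {f : Module.Dual k A} (hf : f ≠ 0) {c : k}
    (hc : ∀ a b, f (a * b) = c * (f a * f b)) (M : Type*) [AddCommGroup M] [Module k M]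
    [Module Aᵐᵒᵖ M] [IsScalarTower k Aᵐᵒᵖ M] [IsSimpleModule Aᵐᵒᵖ M]
    (hfM : ∀ a, op a ∈ Module.annihilator Aᵐᵒᵖ M → f a = 0) :
    ∃ φ : M →ₗ[k] k, Function.Injective φ := by
  let J : Submodule Aᵐᵒᵖ Aᵐᵒᵖ :=
    { (LinearMap.ker (f ∘ₗ (opLinearEquiv k).symm.toLinearMap)).toAddSubmonoid with
      smul_mem' := fun s x (hx : f x.unop = 0) => show f (x.unop * s.unop) = 0 by
        rw [hc, hx, zero_mul, mul_zero] }
  have mem_J : ∀ x, x ∈ J ↔ f x.unop = 0 := fun x => Iff.rfl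
  have hann : Module.annihilator Aᵐᵒᵖ M ≤ Module.annihilator Aᵐᵒᵖ (Aᵐᵒᵖ ⧸ J) := fun s hs => by
    refine Module.mem_annihilator.mpr fun q => ?_
    obtain ⟨x, rfl⟩ := J.mkQ_surjective q
    rw [← map_smul, Submodule.mkQ_apply, Submodule.Quotient.mk_eq_zero, mem_J, smul_eq_mul,
      unop_mul, hc, hfM s.unop hs, mul_zero, mul_zero]
  have : Nontrivial (Aᵐᵒᵖ ⧸ J) := Submodule.Quotient.nontrivial_iff.mpr fun hJ =>
    hf (LinearMap.ext fun a => (mem_J (op a)).mp (hJ ▸ Submodule.mem_top))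
  obtain ⟨g, hg⟩ := exists_ne_zero_of_traceSubmodule_eq_top
    (traceSubmodule_eq_top_of_annihilator_le hann)
  let fbar : (Aᵐᵒᵖ ⧸ J) →ₗ[k] k := (J.restrictScalars k).liftQ
    (f ∘ₗ (opLinearEquiv k : A ≃ₗ[k] Aᵐᵒᵖ).symm.toLinearMap) fun x hx => hx
  have hfbar : Function.Injective fbar := by
    refine (injective_iff_map_eq_zero _).mpr fun q hq => ?_
    obtain ⟨x, rfl⟩ := J.mkQ_surjective q
    exact (Submodule.Quotient.mk_eq_zero J).mpr hq
  have hg_inj : Function.Injective g := LinearMap.injective_of_ne_zero hg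
  exact ⟨fbar ∘ₗ g.restrictScalars k, hfbar.comp hg_inj⟩

theorem exists_injective_of_dualIsPointed [FiniteDimensional k A] (hA : DualIsPointed k A)
    (M : Type*) [AddCommGroup M] [Module k M] [Module Aᵐᵒᵖ M] [IsScalarTower k Aᵐᵒᵖ M]
    [IsSimpleModule Aᵐᵒᵖ M] : ∃ φ : M →ₗ[k] k, Function.Injective φ := by
  let I : Submodule k A := ((Module.annihilator Aᵐᵒᵖ M).restrictScalars k).comap
    (opLinearEquiv k : A ≃ₗ[k] Aᵐᵒᵖ).toLinearMap
  have mem_I : ∀ a, a ∈ I ↔ ∀ m : M, op a • m = 0 := fun a => Module.mem_annihilator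
  have hl : ∀ a, ∀ b ∈ I, a * b ∈ I := fun a b hb => (mem_I _).mpr fun m => by
    rw [op_mul, mul_smul, (mem_I b).mp hb]
  have hr : ∀ a ∈ I, ∀ b, a * b ∈ I := fun a ha b => (mem_I _).mpr fun m => by
    rw [op_mul, mul_smul, (mem_I a).mp ha, smul_zero]
  have hne : I.dualAnnihilator ≠ ⊥ := fun hbot => by
    have htop : I = ⊤ := by
      rw [← Subspace.dualAnnihilator_inj, hbot, Submodule.dualAnnihilator_top]
    have := IsSimpleModule.nontrivial Aᵐᵒᵖ M
    obtain ⟨m, hm⟩ := exists_ne (0 : M)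
    exact hm ((one_smul Aᵐᵒᵖ m).symm.trans ((mem_I 1).mp (htop ▸ Submodule.mem_top) m))
  let := dualCoalgebra k A
  obtain ⟨D, hDI, hD⟩ := exists_isSimpleSubcoalgebra_le (isSubcoalgebra_dualAnnihilator I hl hr) hne
  obtain ⟨f, hfD, hf, c, hc⟩ := exists_comul_eq_smul_tmul_self hD.1 (hA D hD)
  have hmul (a b : A) : f (a * b) = c * (f a * f b) := by
    have hf_comul : dualComul k A f = c • (f ⊗ₜ f) := hc
    rw [← dualDistrib_dualComul, hf_comul, map_smul]
    rfl
  have : Module.Finite k Aᵐᵒᵖ := .equiv (opLinearEquiv k : A ≃ₗ[k] Aᵐᵒᵖ)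
  have : IsArtinianRing Aᵐᵒᵖ := .of_finite k Aᵐᵒᵖ
  exact exists_injective_of_mul_eq hf hmul M
    fun a ha => (Submodule.mem_dualAnnihilator f).mp (hDI hfD) a ha

end Dual

theorem isSemisimpleModule_of_injective {k S M : Type*} [Field k] [Ring S] [Algebra k S]
    [AddCommGroup M] [Module k M] [Module S M] [IsScalarTower k S M]
    (φ : M →ₗ[k] k) (hφ : Function.Injective φ) : IsSemisimpleModule S M := by
  have eq_bot_or_eq_top (X : Submodule S M) : X = ⊥ ∨ X = ⊤ := by
    refine or_iff_not_imp_left.mpr fun hX => eq_top_iff.mpr fun y _ => ?_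
    obtain ⟨x, hxX, hx⟩ := X.ne_bot_iff.mp hX
    have hφx : φ x ≠ 0 := (map_ne_zero_iff φ hφ).mpr hx
    have hy : (φ y / φ x) • x = y :=
      hφ (by rw [map_smul, smul_eq_mul, div_mul_cancel₀ _ hφx])
    exact hy ▸ X.smul_of_tower_mem _ hxX
  have : ComplementedLattice (Submodule S M) := ⟨fun X => (eq_bot_or_eq_top X).elim
    (fun h => ⟨⊤, h ▸ isCompl_bot_top⟩) fun h => ⟨⊥, h ▸ isCompl_top_bot⟩⟩
  exact {}

theorem chevalleyProperty_of_dualIsPointed {k : Type v} [Field k] {A : Type u} [Ring A]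
    [Bialgebra k A] [FiniteDimensional k A] (hA : DualIsPointed k A) : ChevalleyProperty k A := by
  intro M N _ _ _ _ _ _ _ _ hM hN
  obtain ⟨φ, hφ⟩ := exists_injective_of_dualIsPointed hA M
  obtain ⟨ψ, hψ⟩ := exists_injective_of_dualIsPointed hA N
  refine isSemisimpleModule_of_injective ((TensorProduct.lid k k).toLinearMap ∘ₗ
    TensorProduct.map φ ψ ∘ₗ (RightTensor.of k M N).symm.toLinearMap) ?_
  exact (TensorProduct.lid k k).injective.comp
    ((TensorProduct.map_injective_of_flat_flat φ ψ hφ hψ).comp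
      (RightTensor.of k M N).symm.injective)

end Pointed

/-! ### Finiteness of the depth -/

namespace HopfSubalgebra

variable {k : Type v} {H : Type u} [Field k] [Ring H] [HopfAlgebra k H] [FiniteDimensional k H]
  (R : HopfSubalgebra k H)

instance (n : ℕ) : Module.Finite k (R.permPow n).carrier := by
  induction n with
  | zero => exact inferInstanceAs (Module.Finite k R.permMod.carrier)
  | succ n _ => exact RightTensor.finite_rightTensor (M := (R.permPow n).carrier)

instance (n : ℕ) : Module.Finite k (R.permPowRes n).carrier :=
  inferInstanceAs (Module.Finite k (R.permPow n).carrier)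

instance (n : ℕ) : Module.Finite Hᵐᵒᵖ (R.permPow n).carrier :=
  .of_restrictScalars_finite k Hᵐᵒᵖ _

instance (n : ℕ) : Module.Finite R.Carrierᵐᵒᵖ (R.permPowRes n).carrier :=
  .of_restrictScalars_finite k R.Carrierᵐᵒᵖ _

theorem minDepth_lt_top_of_finiteRepresentationType (hH : FiniteRepresentationType H) :
    minDepth R.toSubalgebra < ⊤ := by
  have : Module.Finite k Hᵐᵒᵖ := .equiv (opLinearEquiv k)
  have : IsArtinianRing Hᵐᵒᵖ := .of_finite k Hᵐᵒᵖ
  let : Module R.Carrierᵐᵒᵖ Hᵐᵒᵖ := Module.compHom Hᵐᵒᵖ (AlgHom.op R.toSubalgebra.val).toRingHom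
  let (n : ℕ) : Module R.Carrierᵐᵒᵖ (R.permPow n).carrier :=
    inferInstanceAs (Module R.Carrierᵐᵒᵖ (R.permPowRes n).carrier)
  have (n : ℕ) : IsScalarTower R.Carrierᵐᵒᵖ Hᵐᵒᵖ (R.permPow n).carrier :=
    ⟨fun r a m => mul_smul (op (r.unop : H)) a m⟩
  obtain ⟨n, hn⟩ := exists_summandOfMultiple_of_finiteRepresentationType hH
    (fun n => (R.permPow n).carrier) R.summandOfMultiple_permPowRes_succ
  exact R.minDepth_lt_top_of_summandOfMultiple hn

theorem minDepth_lt_top_of_finiteRepresentationType_carrier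
    (hR : FiniteRepresentationType R.Carrier) : minDepth R.toSubalgebra < ⊤ := by
  have : Module.Finite k R.Carrierᵐᵒᵖ := .equiv (opLinearEquiv k)
  have : IsArtinianRing R.Carrierᵐᵒᵖ := .of_finite k R.Carrierᵐᵒᵖ
  obtain ⟨n, hn⟩ := exists_summandOfMultiple_of_finiteRepresentationType hR
    (fun n => (R.permPowRes n).carrier) R.summandOfMultiple_permPowRes_succ
  exact R.minDepth_lt_top_of_summandOfMultiple hn

theorem minDepth_lt_top_of_projective (hV : Module.Projective Hᵐᵒᵖ R.PermModule) :
    minDepth R.toSubalgebra < ⊤ := by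
  have : Module.Finite k Hᵐᵒᵖ := .equiv (opLinearEquiv k)
  have : IsNoetherianRing Hᵐᵒᵖ := .of_finite k Hᵐᵒᵖ
  have (n : ℕ) : Module.Projective Hᵐᵒᵖ (R.permPow n).carrier := by
    cases n with
    | zero => exact hV
    | succ n =>
      have : Module.Projective Hᵐᵒᵖ R.permMod.carrier := hV
      have : Module.Finite Hᵐᵒᵖ R.permMod.carrier := .of_restrictScalars_finite k Hᵐᵒᵖ _
      exact RightTensor.projective (M := (R.permPow n).carrier) (N := R.permMod.carrier)
  obtain ⟨n, hn⟩ := exists_summandOfMultiple_of_projective (fun n => (R.permPow n).carrier)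
    R.permPowProj R.permPowProj_surjective
  exact R.minDepth_lt_top_of_summandOfMultiple (KRightMod.summandOfMultiple_restrict _ hn)

theorem minDepth_lt_top_of_projective_carrier (hV : Module.Projective R.Carrierᵐᵒᵖ R.PermModule) :
    minDepth R.toSubalgebra < ⊤ := by
  have : Module.Finite k R.Carrierᵐᵒᵖ := .equiv (opLinearEquiv k)
  have : IsNoetherianRing R.Carrierᵐᵒᵖ := .of_finite k R.Carrierᵐᵒᵖ
  have (n : ℕ) : Module.Projective R.Carrierᵐᵒᵖ (R.permPowRes n).carrier := by
    cases n with
    | zero => exact hV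
    | succ n =>
      let V := R.permMod.restrict (R.inclHom : R.Carrier →ₐ[k] H)
      have : Module.Projective R.Carrierᵐᵒᵖ V.carrier := hV
      have : Module.Finite R.Carrierᵐᵒᵖ V.carrier :=
        inferInstanceAs (Module.Finite R.Carrierᵐᵒᵖ (R.permPowRes 0).carrier)
      have : Module.Projective R.Carrierᵐᵒᵖ ((R.permPowRes n).tensor V).carrier :=
        RightTensor.projective (M := (R.permPowRes n).carrier) (N := V.carrier)
      exact .of_equiv (KRightMod.tensorRestrictEquiv R.inclHom (R.permPow n) R.permMod)
  obtain ⟨n, hn⟩ := exists_summandOfMultiple_of_projective (fun n => (R.permPowRes n).carrier)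
    (fun n => KRightMod.restrictHom (R.inclHom : R.Carrier →ₐ[k] H) (R.permPowProj n))
    R.permPowProj_surjective
  exact R.minDepth_lt_top_of_summandOfMultiple hn

theorem minDepth_lt_top_of_isSemisimpleModule
    (hV : IsSemisimpleModule R.Carrierᵐᵒᵖ R.PermModule) (hR : ChevalleyProperty k R.Carrier) :
    minDepth R.toSubalgebra < ⊤ := by
  have : Module.Finite k R.Carrierᵐᵒᵖ := .equiv (opLinearEquiv k)
  have : IsArtinianRing R.Carrierᵐᵒᵖ := .of_finite k R.Carrierᵐᵒᵖ
  have (n : ℕ) : IsSemisimpleModule R.Carrierᵐᵒᵖ (R.permPowRes n).carrier := by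
    induction n with
    | zero => exact hV
    | succ n _ =>
      let V := R.permMod.restrict (R.inclHom : R.Carrier →ₐ[k] H)
      have : IsSemisimpleModule R.Carrierᵐᵒᵖ V.carrier := hV
      have : IsSemisimpleModule R.Carrierᵐᵒᵖ ((R.permPowRes n).tensor V).carrier :=
        RightTensor.isSemisimpleModule hR
      exact .congr (KRightMod.tensorRestrictEquiv R.inclHom (R.permPow n) R.permMod).symm
  obtain ⟨n, hn⟩ := exists_summandOfMultiple_of_isSemisimpleModule
    (fun n => (R.permPowRes n).carrier)
    (fun n => KRightMod.restrictHom (R.inclHom : R.Carrier →ₐ[k] H) (R.permPowProj n))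
    R.permPowProj_surjective
  exact R.minDepth_lt_top_of_summandOfMultiple hn

end HopfSubalgebra

end HopfDepth

end

theorem mainTheorem3 {k : Type v} {H : Type u} [Field k] [Ring H] [HopfAlgebra k H]
    [FiniteDimensional k H] (R : HopfDepth.HopfSubalgebra k H) :
    -- (1) `R` or `H` has finite representation type
    (HopfDepth.FiniteRepresentationType R.Carrier ∨ HopfDepth.FiniteRepresentationType H →
      HopfDepth.minDepth R.toSubalgebra < ⊤) ∧
    -- (2) `V` is projective, as an `R`-module or as an `H`-module
    (Module.Projective R.Carrierᵐᵒᵖ R.PermModule ∨ Module.Projective Hᵐᵒᵖ R.PermModule →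
      HopfDepth.minDepth R.toSubalgebra < ⊤) ∧
    -- (3) `V` is a semisimple `R`-module and `R` has the Chevalley property
    (IsSemisimpleModule R.Carrierᵐᵒᵖ R.PermModule ∧ HopfDepth.ChevalleyProperty k R.Carrier →
      HopfDepth.minDepth R.toSubalgebra < ⊤) ∧
    -- `R` has the Chevalley property if `R*` is pointed
    (HopfDepth.DualIsPointed k R.Carrier → HopfDepth.ChevalleyProperty k R.Carrier) :=
  ⟨fun h => h.elim R.minDepth_lt_top_of_finiteRepresentationType_carrier
      R.minDepth_lt_top_of_finiteRepresentationType,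
    fun h => h.elim R.minDepth_lt_top_of_projective_carrier R.minDepth_lt_top_of_projective,
    fun h => R.minDepth_lt_top_of_isSemisimpleModule h.1 h.2,
    HopfDepth.chevalleyProperty_of_dualIsPointed⟩
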